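/- Let $n$ be a natural number and let $a=(a_1,\dots,a_n)$ be rational numbers with $0<a_i<1$. Put $$F(a|z)=\sum_{k\ge 0}\frac{(a_1)_k\cdots(a_n)_k}{k!^n}z^k,\qquad G(a|z)=\sum_{k\ge 1}\frac{(a_1)_k\cdots(a_n)_k}{k!^n}\Big[\sum_{j=1}^n\sum_{i=0}^{k-1}\Big(\frac1{a_j+i}-\frac1{1+i}\Big)\Big]z^k,$$ where $(x)_k=x(x+1)\cdots(x+k-1)$ and $(x)_0=1$, and let the mirror map be the formal power series $q(a|z)=z\exp\big(G(a|z)/F(a|z)\big)\in\mathbb{Q}[[z]]$. A prime $p$ is called good (for $a$) if it divides the denominator of no $a_i$. For a rational number $x$ whose denominator is not divisible by $p$, put $\delta_p(x)=(x+x_0)/p$, where $0\le x_0\le p-1$ is the unique integer such that $p$ does not divide the denominator of $(x+x_0)/p$. For a good prime $p$ consider the following condition, in which $\{\cdot\}$ denotes multisets: $$(C_p)\qquad \{\delta_p(a_1),\dots,\delta_p(a_n)\}=\{a_1,\dots,a_n\},\quad\text{or } n=2 \text{ and } \{\delta_p(a_1),\delta_p(a_2)\}=\{1-a_1,1-a_2\}.$$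 1. For every good prime $p$ for which $(C_p)$ holds, $q(a|z)$ is $p$-integral, that is, $p$ divides the denominator of none of its coefficients. 2. If $(C_p)$ holds for every good prime $p$, then $q(a|z)$ is $N$-integral, that is, there is an integer $N\ge 1$ such that $q(a|Nz)$ has integer coefficients. -/

import Mathlib

namespace HypMirror

open PowerSeries

noncomputable section

/-- The coefficient `(a₁)_k ⋯ (aₙ)_k / (k!)ⁿ` of the hypergeometric series. -/
def hypCoeff {n : ℕ} (a : Fin n → ℚ) (k : ℕ) : ℚ :=
  (∏ j, (ascPochhammer ℚ k).eval (a j)) / (k.factorial : ℚ) ^ n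

/-- The holomorphic solution `F(a|z) = ₙFₙ₋₁(a₁,…,aₙ; 1,…,1 | z)`, as a formal power series. -/
def hypF {n : ℕ} (a : Fin n → ℚ) : PowerSeries ℚ :=
  PowerSeries.mk (hypCoeff a)

/-- The power series `G(a|z)` such that `G(a|z) + F(a|z) log z` is the first logarithmic
solution; its constant term is `0` (the inner sum is empty for `k = 0`). -/
def hypG {n : ℕ} (a : Fin n → ℚ) : PowerSeries ℚ :=
  PowerSeries.mk fun k =>
    hypCoeff a k * ∑ j, ∑ i ∈ Finset.range k, (1 / (a j + (i : ℚ)) - 1 / (1 + (i : ℚ)))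

/-- The mirror map `q(a|z) = z · exp(G(a|z) / F(a|z))`, as a formal power series. -/
def mirrorMap {n : ℕ} (a : Fin n → ℚ) : PowerSeries ℚ :=
  X * (PowerSeries.exp ℚ).subst (hypG a * (hypF a)⁻¹)

/-- The prime `p` divides the denominator of no coefficient of `f`. -/
def PIntegral (p : ℕ) (f : PowerSeries ℚ) : Prop :=
  ∀ k, ¬ p ∣ (coeff k f).den

/-- There is a positive integer `N` such that `f(Nz)` has integral coefficients. -/
def NIntegral (f : PowerSeries ℚ) : Prop :=
  ∃ N : ℕ, 0 < N ∧ ∀ k, ∃ m : ℤ, coeff k (rescale (N : ℚ) f) = (m : ℚ)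

/-- The integer `0 ≤ x₀ ≤ p - 1` such that `p` does not divide the denominator of
`(x + x₀) / p`; it exists and is unique whenever the prime `p` does not divide the denominator
of `x`, see `existsUnique_dworkDigit`. -/
def dworkDigit (p : ℕ) (x : ℚ) : ℕ :=
  sInf {x₀ : ℕ | x₀ < p ∧ ¬ p ∣ ((x + x₀) / p).den}

/-- The Dwork operator `δ_p(x) = (x + x₀) / p`. -/
def dwork (p : ℕ) (x : ℚ) : ℚ :=
  (x + dworkDigit p x) / p

/-- `p` is a good prime for `a`: it is a prime dividing none of the denominators of the `a_i`. -/
def IsGoodPrime (p : ℕ) {n : ℕ} (a : Fin n → ℚ) : Prop :=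
  p.Prime ∧ ∀ i, ¬ p ∣ (a i).den

/-- The multiset `{x₁, …, xₙ}` of entries of an `n`-tuple. -/
def entries {n : ℕ} (x : Fin n → ℚ) : Multiset ℚ :=
  Finset.univ.val.map x

/-- The condition on `a` at `p`: the multiset `{δ_p(a₁), …, δ_p(aₙ)}` equals `{a₁, …, aₙ}` or,
only when `n = 2`, it equals `{1 - a₁, 1 - a₂}`. -/
def DworkCondition (p : ℕ) {n : ℕ} (a : Fin n → ℚ) : Prop :=
  entries (fun i => dwork p (a i)) = entries a ∨
    (n = 2 ∧ entries (fun i => dwork p (a i)) = entries fun i => 1 - a i)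

theorem constantCoeff_hypF {n : ℕ} (a : Fin n → ℚ) : constantCoeff (hypF a) = 1 := by
  simp [hypF, hypCoeff, ← coeff_zero_eq_constantCoeff_apply]

/-- The substitution in `mirrorMap` is legitimate. -/
theorem hasSubst_hypG_div_hypF {n : ℕ} (a : Fin n → ℚ) :
    PowerSeries.HasSubst (hypG a * (hypF a)⁻¹) := by
  apply PowerSeries.HasSubst.of_constantCoeff_zero'
  have h : constantCoeff (hypG a) = 0 := by
    simp [hypG, ← coeff_zero_eq_constantCoeff_apply]
  simp [h]

theorem not_dvd_den_div_iff {p : ℕ} (hp : p.Prime) {x : ℚ} (hx : ¬ p ∣ x.den) (m : ℕ) :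
    ¬ p ∣ ((x + m) / p).den ↔ ((x.num + m * x.den : ℤ) : ZMod p) = 0 := by
  have hp0 : (p : ℚ) ≠ 0 := by exact_mod_cast hp.ne_zero
  have hd0 : (x.den : ℚ) ≠ 0 := by exact_mod_cast x.den_ne_zero
  have hxq : x * x.den = x.num := Rat.mul_den_eq_num x
  rw [ZMod.intCast_zmod_eq_zero_iff_dvd]
  constructor
  · intro h
    set y := (x + m) / p with hy
    have hyq : y * y.den = y.num := Rat.mul_den_eq_num y
    have hyp : y * p = x + m := by rw [hy]; field_simp
    have e : ((x.num + m * x.den : ℤ) : ℚ) * y.den = p * (y.num * x.den) := by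
      push_cast
      rw [← hxq, ← hyq]
      linear_combination (- (x.den : ℚ) * y.den) * hyp
    have e' : (x.num + m * x.den : ℤ) * (y.den : ℤ) = p * (y.num * x.den) := by exact_mod_cast e
    have hd : (p : ℤ) ∣ (x.num + m * x.den : ℤ) * (y.den : ℤ) := ⟨_, e'⟩
    rcases (Nat.prime_iff_prime_int.mp hp).dvd_or_dvd hd with h1 | h1
    · exact h1
    · exact absurd (by exact_mod_cast h1) h
  · rintro ⟨c, hc⟩ h
    apply hx
    have hcq : (x.num : ℚ) + m * x.den = p * c := by exact_mod_cast hc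
    have e : (x + m) / p = (c : ℚ) / ((x.den : ℤ) : ℚ) := by
      push_cast
      field_simp
      linear_combination hxq + hcq
    rw [e] at h
    have h2 : (((c : ℚ) / ((x.den : ℤ) : ℚ)).den : ℤ) ∣ (x.den : ℤ) := by
      rw [← Rat.divInt_eq_div]
      exact Rat.den_dvd c x.den
    exact h.trans (by exact_mod_cast h2)

theorem existsUnique_dworkDigit {p : ℕ} (hp : p.Prime) {x : ℚ} (hx : ¬ p ∣ x.den) :
    ∃! x₀ : ℕ, x₀ < p ∧ ¬ p ∣ ((x + x₀) / p).den := by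
  have : Fact p.Prime := ⟨hp⟩
  have hd : (x.den : ZMod p) ≠ 0 := by
    rwa [Ne, ZMod.natCast_eq_zero_iff]
  refine ⟨(-(x.num : ZMod p) / x.den).val, ⟨ZMod.val_lt _, ?_⟩, ?_⟩
  · rw [not_dvd_den_div_iff hp hx]
    push_cast
    rw [ZMod.natCast_val, ZMod.cast_id]
    field_simp
    ring
  · rintro m ⟨hm, h⟩
    rw [not_dvd_den_div_iff hp hx] at h
    push_cast at h
    have : (-(x.num : ZMod p) / x.den) = m := by
      rw [div_eq_iff hd]
      linear_combination -h
    rw [this, ZMod.val_natCast_of_lt hm]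

/-- For a prime `p` not dividing the denominator of `x`, the digit used by `dwork` has its
defining property. -/
theorem dworkDigit_spec {p : ℕ} (hp : p.Prime) {x : ℚ} (hx : ¬ p ∣ x.den) :
    dworkDigit p x < p ∧ ¬ p ∣ (dwork p x).den :=
  Nat.sInf_mem (s := {x₀ : ℕ | x₀ < p ∧ ¬ p ∣ ((x + x₀) / p).den})
    (existsUnique_dworkDigit hp hx).exists

end

end HypMirror

/-!
The proof shows, for a good prime `p`, that `f = G(a|z) / F(a|z)` satisfies Dwork's congruence, and
then applies the Dieudonné–Dwork criterion: a power series `f` over `ℚ_[p]` without constant term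
has `exp f` with coefficients in `ℤ_[p]` as soon as `f(z^p) - p f(z)` is `p` times an integral
series (`expSeries_mem_integralSeries`).

**Dwork's congruence.** Write `A_b(k)` for the hypergeometric coefficient with parameters `b`,
`H_b(k)` for the harmonic sum in `G`, and `b'` for the image of `b` under the Dwork operator.
Splitting off the lowest digit `u` of an index, and separating the factors of the Pochhammer symbols
which are `p`-adic units from the others, gives
`A_b(p r + u) = A_{b'}(r) D_u(r)` (`padicCoeff_mul_add`). By a Wilson type argument, the product of
all units modulo `p ^ s` being the same for numerator and denominator, `D_u` satisfies
`D_u(r) ≡ D_u(t)` modulo `p ^ (s + 1)` whenever `r ≡ t` modulo `p ^ s`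
(`digitFactor_congr`); no sign appears, so `p = 2` needs no separate treatment. Similarly
`A_b(p r + u) (p H_b(p r + u) - H_{b'}(r))` is divisible by `p`. Up to multiples of `p`, the
coefficients of `G_{b'}(z^p) F_b(z) - p G_b(z) F_{b'}(z^p)` are therefore sums
`∑ H_{b'}(r) A_{b'}(r) A_{b'}(t) (D_u(t) - D_u(r))` over `r + t = J`, and the congruence amounts to
the integrality of
`∑_{r + t = K} H_b(r) A_b(r) A_b(t) (η(r, t) - η(t, r))` for every `1`-Lipschitz function `η`
(`sum_padicHarm_mul_mem`). This is proved by induction on `K`: splitting off the lowest digits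
of `r` and `t` turns such a sum into an integral quantity plus sums of the same shape for `b'` and
for smaller `K`. The factor `1 / p` created by the harmonic sums is absorbed because the new
function of `(r, t)` is constant modulo `p`, and constants cancel in `η(r, t) - η(t, r)`.

**The two cases of the condition.** If `{δ_p(a_i)} = {a_i}`, the two ratios in the congruence
coincide. For `n = 2` and `{δ_p(a_i)} = {1 - a_i}` they coincide as well (`ratio_reflection`):
Euler's transformation gives `F(a) = (1 - z)^(1 - a₁ - a₂) F(1 - a)`, and the Wronskian of the
hypergeometric equation expresses `θ(G / F)` through `F`.

**Bad primes.** At any prime the coefficients of `F` and `G` grow at most exponentially in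
`p`-adic absolute value. Hence `G(p^m z) / F(p^m z)` is `p` times an integral series for large `m`,
and its exponential is integral because `p ^ d / d!` is. Only the finitely many primes dividing a
denominator of some `a_i` have to be treated in this way, which yields `N`.
-/

namespace HypMirror

open Finset

/-! ### Unit parts of Pochhammer symbols -/

section PadicProducts

variable {p : ℕ} [hp : Fact p.Prime]

/-- The part of a product over `i < p * r + u` where `i` has residue `c` modulo `p`. -/
@[to_additive]
theorem prod_range_ite_mod_eq {M : Type*} [CommMonoid M] {p c : ℕ} (hc : c < p) (g : ℕ → M)
    (r : ℕ) {u : ℕ} (hu : u ≤ p) :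
    ∏ i ∈ range (p * r + u), (if i % p = c then g i else 1) =
      (∏ l ∈ range r, g (p * l + c)) * if c < u then g (p * r + c) else 1 := by
  have key : ∀ (r u : ℕ), u ≤ p →
      ∏ j ∈ range u, (if (p * r + j) % p = c then g (p * r + j) else 1) =
        if c < u then g (p * r + c) else 1 := by
    intro r u hu
    rw [prod_congr rfl (g := fun j => if j = c then g (p * r + j) else 1)]
    · simp [prod_ite_eq']
    · intro j hj
      have hj' : j < p := (mem_range.mp hj).trans_le hu
      rw [Nat.mul_add_mod, Nat.mod_eq_of_lt hj']
  rw [prod_range_add, key r u hu]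
  congr 1
  induction r with
  | zero => simp
  | succ r ih => rw [mul_add, mul_one, prod_range_add, ih, key r p le_rfl, prod_range_succ, if_pos hc]

@[to_additive]
theorem prod_range_split_mod {M : Type*} [CommMonoid M] {p c : ℕ} (hc : c < p) (g : ℕ → M)
    (r : ℕ) {u : ℕ} (hu : u ≤ p) :
    ∏ i ∈ range (p * r + u), g i =
      (∏ i ∈ range (p * r + u), if i % p = c then 1 else g i) *
        ((∏ l ∈ range r, g (p * l + c)) * if c < u then g (p * r + c) else 1) := by
  rw [← prod_range_ite_mod_eq hc g r hu, ← prod_mul_distrib]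
  refine prod_congr rfl fun i _ => ?_
  split_ifs <;> simp

/-- `x'` is the image of `x` under the Dwork operator, with digit `c`. The relation is stated without
division, so that it lives in `ℤ_[p]`. -/
def IsShift (x x' : ℤ_[p]) (c : ℕ) : Prop :=
  c < p ∧ (p : ℤ_[p]) * x' = x + c

theorem exists_isShift (x : ℤ_[p]) : ∃ x' c, IsShift x x' c := by
  have h := PadicInt.sub_zmodRepr_mem (-x)
  rw [PadicInt.maximalIdeal_eq_span_p, Ideal.mem_span_singleton] at h
  obtain ⟨y, hy⟩ := h
  exact ⟨-y, (-x).zmodRepr, PadicInt.zmodRepr_lt_p _, by linear_combination hy⟩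

/-- The parameter `1`, to which the factorials belong, is fixed; its digit `p - 1` is never less than
a digit `u`. -/
theorem isShift_one : IsShift (1 : ℤ_[p]) 1 (p - 1) := by
  have := hp.out.pos
  refine ⟨by omega, ?_⟩
  rw [Nat.cast_sub this]; simp

theorem IsShift.isUnit_iff {x x' : ℤ_[p]} {c : ℕ} (h : IsShift x x' c) (i : ℕ) :
    IsUnit (x + i) ↔ i % p ≠ c := by
  rw [← not_iff_not, ← mem_nonunits_iff, PadicInt.mem_nonunits, PadicInt.norm_lt_one_iff_dvd,
    not_not]
  have e : x + i = ((i : ℤ) - (c : ℤ) : ℤ) + (p : ℤ_[p]) * x' := by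
    rw [h.2]; push_cast; ring
  have h1 := PadicInt.pow_p_dvd_int_iff (p := p) 1 ((i : ℤ) - (c : ℤ))
  rw [pow_one, pow_one] at h1
  rw [e, dvd_add_left (dvd_mul_right _ _), h1, ← Int.modEq_iff_dvd,
    Int.natCast_modEq_iff, Nat.ModEq, Nat.mod_eq_of_lt h.1, eq_comm]

theorem IsShift.apply_add {x x' : ℤ_[p]} {c : ℕ} (h : IsShift x x' c) (l : ℕ) :
    x + ((p * l + c : ℕ) : ℤ_[p]) = p * (x' + l) := by
  push_cast; linear_combination -h.2

open Classical in
/-- The product of the `p`-adic units among `x, x + 1, …, x + k - 1`. -/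
noncomputable def unitProd (x : ℤ_[p]) (k : ℕ) : ℤ_[p] :=
  ∏ i ∈ range k, if IsUnit (x + i) then x + i else 1

theorem isUnit_unitProd (x : ℤ_[p]) (k : ℕ) : IsUnit (unitProd x k) := by
  rw [unitProd, IsUnit.prod_iff]
  intro i _
  split_ifs with h
  · exact h
  · exact isUnit_one

theorem unitProd_add (x : ℤ_[p]) (k m : ℕ) :
    unitProd x (k + m) = unitProd x k * unitProd (x + (k : ℤ_[p])) m := by
  simp only [unitProd, prod_range_add]
  congr 1
  refine prod_congr rfl fun i _ => ?_
  have h : x + ((k + i : ℕ) : ℤ_[p]) = x + k + i := by push_cast; ring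
  rw [h]

theorem IsShift.prod_range {x x' : ℤ_[p]} {c : ℕ} (h : IsShift x x' c) (r : ℕ) {u : ℕ}
    (hu : u < p) :
    ∏ i ∈ range (p * r + u), (x + i) =
      unitProd x (p * r + u) * (p ^ r * (∏ l ∈ range r, (x' + l)) *
        if c < u then (p : ℤ_[p]) * (x' + r) else 1) := by
  rw [prod_range_split_mod h.1 (fun i : ℕ => x + (i : ℤ_[p])) r hu.le, unitProd]
  congr 1
  · refine prod_congr rfl fun i _ => ?_
    have := h.isUnit_iff i
    split_ifs <;> first | rfl | (exfalso; tauto)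
  · simp only [h.apply_add, prod_mul_distrib, prod_const, card_range]

open Classical in
/-- Wilson type statement: modulo `p ^ s`, the units among any `p ^ s` consecutive translates of `x`
run through all units of `ℤ / p ^ s`, whatever `x` is. -/
theorem toZModPow_unitProd (x : ℤ_[p]) {s : ℕ} (hs : s ≠ 0) :
    PadicInt.toZModPow s (unitProd x (p ^ s)) =
      ∏ y : ZMod (p ^ s), if IsUnit y then y else 1 := by
  have : Fact (1 < p ^ s) := ⟨Nat.one_lt_pow hs hp.out.one_lt⟩
  have : NeZero (p ^ s) := ⟨by have := hp.out.pos; positivity⟩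
  have hu : ∀ z : ℤ_[p], IsUnit (PadicInt.toZModPow s z) ↔ IsUnit z := by
    refine fun z => ⟨fun h => ?_, fun h => h.map _⟩
    by_contra hz
    rw [← mem_nonunits_iff, PadicInt.mem_nonunits, PadicInt.norm_lt_one_iff_dvd] at hz
    have h1 : (PadicInt.toZModPow s z) ^ s = 0 := by
      rw [← map_pow, ← RingHom.mem_ker, PadicInt.ker_toZModPow, Ideal.mem_span_singleton]
      exact pow_dvd_pow_of_dvd hz s
    exact not_isUnit_zero (h1 ▸ h.pow s)
  have h2 : PadicInt.toZModPow s (unitProd x (p ^ s)) =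
      ∏ i ∈ range (p ^ s), (fun y : ZMod (p ^ s) => if IsUnit (PadicInt.toZModPow s x + y) then
        PadicInt.toZModPow s x + y else 1) (i : ZMod (p ^ s)) := by
    rw [unitProd, map_prod]
    refine prod_congr rfl fun i _ => ?_
    have := hu (x + i)
    rw [map_add, map_natCast] at this
    simp only [apply_ite (PadicInt.toZModPow (p := p) s), map_add, map_natCast, map_one, this]
  rw [h2, ← Equiv.prod_comp (Equiv.addLeft (PadicInt.toZModPow s x))]
  refine prod_nbij' (fun i => (i : ZMod (p ^ s))) ZMod.val (by simp) ?_ ?_ (by simp)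
    (fun i _ => by simp only [Equiv.coe_addLeft]; congr)
  · intro y _; exact mem_range.mpr (ZMod.val_lt y)
  · intro i hi; exact ZMod.val_cast_of_lt (mem_range.mp hi)

theorem toZModPow_unitProd_add_mul (x : ℤ_[p]) {s : ℕ} (hs : s ≠ 0) (k m : ℕ) :
    PadicInt.toZModPow s (unitProd x (k + p ^ s * m)) =
      PadicInt.toZModPow s (unitProd x k) * PadicInt.toZModPow s (unitProd (1 : ℤ_[p]) (p ^ s)) ^ m := by
  induction m with
  | zero => simp
  | succ m ih =>
    rw [mul_add, mul_one, ← add_assoc, unitProd_add, map_mul, ih, toZModPow_unitProd _ hs,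
      toZModPow_unitProd _ hs, pow_succ, mul_assoc]

theorem pow_dvd_sub_iff (s : ℕ) (x y : ℤ_[p]) :
    (p : ℤ_[p]) ^ s ∣ x - y ↔ PadicInt.toZModPow s x = PadicInt.toZModPow s y := by
  rw [← Ideal.mem_span_singleton, ← PadicInt.ker_toZModPow, RingHom.mem_ker, map_sub, sub_eq_zero]

/-- The ratio of the unit parts of `(x)_k` and `k! = (1)_k`. -/
noncomputable def unitRatio (x : ℤ_[p]) (k : ℕ) : ℤ_[p] :=
  unitProd x k * Ring.inverse (unitProd (1 : ℤ_[p]) k)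

theorem unitRatio_mul (x : ℤ_[p]) (k : ℕ) : unitRatio x k * unitProd (1 : ℤ_[p]) k = unitProd x k := by
  rw [unitRatio, mul_assoc, Ring.inverse_mul_cancel _ (isUnit_unitProd (1 : ℤ_[p]) k), mul_one]

/-- The unit part of `(x)_k / k!` is `1`-Lipschitz in `k`: numerator and denominator are multiplied by
the same factor modulo `p ^ s` when `k` increases by `p ^ s`. -/
theorem unitRatio_congr (x : ℤ_[p]) {s k m : ℕ} (h : k ≡ m [MOD p ^ s]) :
    (p : ℤ_[p]) ^ s ∣ unitRatio x k - unitRatio x m := by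
  rcases eq_or_ne s 0 with rfl | hs
  · simp
  have red : ∀ k, PadicInt.toZModPow s (unitRatio x k) =
      PadicInt.toZModPow s (unitRatio x (k % p ^ s)) := by
    intro k
    set W := PadicInt.toZModPow s (unitProd (1 : ℤ_[p]) (p ^ s))
    have hW : IsUnit W := (isUnit_unitProd (1 : ℤ_[p]) _).map _
    have h1 := congrArg (PadicInt.toZModPow (p := p) s) (unitRatio_mul (p := p) x k)
    have h2 := congrArg (PadicInt.toZModPow (p := p) s) (unitRatio_mul (p := p) x (k % p ^ s))
    rw [map_mul] at h1 h2
    have e : k = k % p ^ s + p ^ s * (k / p ^ s) := (Nat.mod_add_div _ _).symm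
    have h3 := toZModPow_unitProd_add_mul x hs (k % p ^ s) (k / p ^ s)
    have h4 := toZModPow_unitProd_add_mul (1 : ℤ_[p]) hs (k % p ^ s) (k / p ^ s)
    rw [← e] at h3 h4
    rw [h3, h4, ← h2] at h1
    have hU : IsUnit (PadicInt.toZModPow s (unitProd (1 : ℤ_[p]) (k % p ^ s)) * W ^ (k / p ^ s)) :=
      ((isUnit_unitProd (1 : ℤ_[p]) (k % p ^ s)).map _).mul (hW.pow _)
    refine hU.mul_right_cancel ?_
    rw [h1, mul_assoc]
  rw [pow_dvd_sub_iff, red k, red m, h]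

end PadicProducts

/-! ### Splitting off the lowest digit -/

section PadicCoefficients

variable {p : ℕ} [hp : Fact p.Prime]

theorem dvd_prod_sub_prod {R ι : Type*} [CommRing R] {d : R} (s : Finset ι) {f g : ι → R}
    (h : ∀ i ∈ s, d ∣ f i - g i) : d ∣ ∏ i ∈ s, f i - ∏ i ∈ s, g i := by
  classical
  induction s using Finset.induction_on with
  | empty => simp
  | insert a s ha ih =>
    rw [prod_insert ha, prod_insert ha]
    exact dvd_mul_sub_mul (h a (mem_insert_self a s)) (ih fun i hi => h i (mem_insert_of_mem hi))

theorem pow_dvd_natCast_sub {s r t : ℕ} (h : r ≡ t [MOD p ^ s]) :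
    (p : ℤ_[p]) ^ s ∣ (r : ℤ_[p]) - t := by
  have h1 := (Int.natCast_modEq_iff.mpr h).symm.dvd
  have h2 := (PadicInt.pow_p_dvd_int_iff (p := p) s ((r : ℤ) - t)).mpr (by exact_mod_cast h1)
  simpa using h2

variable {n : ℕ}

/-- The hypergeometric coefficient `(b₁)_k ⋯ (bₙ)_k / k!ⁿ` with `p`-adic integers as parameters. -/
noncomputable def padicCoeff (b : Fin n → ℤ_[p]) (k : ℕ) : ℚ_[p] :=
  ∏ j, ((∏ i ∈ range k, (b j + i) : ℤ_[p]) : ℚ_[p]) / (k.factorial : ℚ_[p])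

/-- The harmonic sum multiplying the hypergeometric coefficient in `G`. A summand `1 / (b j + i)`
with `b j + i = 0` counts as `0`, which is compatible with the recursions below. -/
noncomputable def padicHarm (b : Fin n → ℤ_[p]) (k : ℕ) : ℚ_[p] :=
  ∑ j, ∑ i ∈ range k, (1 / ((b j : ℚ_[p]) + i) - 1 / (1 + (i : ℚ_[p])))

/-- The factor `D_u(r)` by which the coefficient at `p * r + u` differs from the coefficient at `r`
for the image `b'` of `b` under the Dwork operator, with digits `c`. -/
noncomputable def digitFactor (b b' : Fin n → ℤ_[p]) (c : Fin n → ℕ) (u r : ℕ) : ℤ_[p] :=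
  ∏ j, (unitRatio (b j) (p * r + u) * if c j < u then (p : ℤ_[p]) * (b' j + r) else 1)

/-- The modulus gains one power of `p`: this is what compensates the denominator `p` in the harmonic
sums. -/
theorem digitFactor_congr (b b' : Fin n → ℤ_[p]) (c : Fin n → ℕ) (u : ℕ) {s r t : ℕ}
    (h : r ≡ t [MOD p ^ s]) :
    (p : ℤ_[p]) ^ (s + 1) ∣ digitFactor b b' c u r - digitFactor b b' c u t := by
  refine dvd_prod_sub_prod _ fun j _ => dvd_mul_sub_mul (unitRatio_congr _ ?_) ?_
  · refine Nat.ModEq.add_right u ?_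
    rw [pow_succ']
    exact Nat.ModEq.mul_left' p h
  · split_ifs
    · have : (p : ℤ_[p]) * (b' j + r) - p * (b' j + t) = p * ((r : ℤ_[p]) - t) := by ring
      rw [this, pow_succ']
      exact mul_dvd_mul_left _ (pow_dvd_natCast_sub h)
    · simp

theorem natCast_factorial (k : ℕ) : (k.factorial : ℤ_[p]) = ∏ i ∈ range k, (1 + (i : ℤ_[p])) := by
  rw [← prod_range_add_one_eq_factorial]
  push_cast
  exact prod_congr rfl fun i _ => add_comm _ _

theorem padicCoeff_mul_add {b b' : Fin n → ℤ_[p]} {c : Fin n → ℕ}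
    (h : ∀ j, IsShift (b j) (b' j) (c j)) (r : ℕ) {u : ℕ} (hu : u < p) :
    padicCoeff b (p * r + u) = padicCoeff b' r * digitFactor b b' c u r := by
  have hp0 : (p : ℚ_[p]) ≠ 0 := by exact_mod_cast hp.out.ne_zero
  have hf : ((r.factorial : ℤ_[p]) : ℚ_[p]) ≠ 0 := by
    rw [PadicInt.coe_natCast]; exact_mod_cast r.factorial_ne_zero
  have hfac := isShift_one.prod_range r hu
  rw [if_neg (by omega), ← natCast_factorial, ← natCast_factorial, mul_one] at hfac
  have hU : ((unitProd (1 : ℤ_[p]) (p * r + u) : ℤ_[p]) : ℚ_[p]) ≠ 0 :=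
    PadicInt.coe_ne_zero.mpr (isUnit_unitProd (1 : ℤ_[p]) _).ne_zero
  rw [padicCoeff, padicCoeff, digitFactor, show ((∏ j, (unitRatio (b j) (p * r + u) *
    if c j < u then (p : ℤ_[p]) * (b' j + r) else 1) : ℤ_[p]) : ℚ_[p]) = PadicInt.Coe.ringHom _
    from rfl, map_prod, ← prod_mul_distrib]
  refine prod_congr rfl fun j _ => ?_
  rw [(h j).prod_range r hu, ← unitRatio_mul, ← PadicInt.coe_natCast, hfac,
    ← PadicInt.coe_natCast r.factorial]
  change _ = _ * ((_ : ℤ_[p]) : ℚ_[p])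
  push_cast
  rw [PadicInt.coe_natCast] at hf
  field_simp

theorem padicCoeff_zero (b : Fin n → ℤ_[p]) : padicCoeff b 0 = 1 := by simp [padicCoeff]

/-- Integrality of the coefficients, by induction on the number of digits. -/
theorem padicCoeff_mem (b : Fin n → ℤ_[p]) (k : ℕ) : padicCoeff b k ∈ PadicInt.subring p := by
  induction k using Nat.strong_induction_on generalizing b with
  | _ k ih =>
    rcases Nat.eq_zero_or_pos k with rfl | hk
    · rw [padicCoeff_zero]; exact one_mem _
    choose b' c h using fun j => exists_isShift (b j)
    rw [← Nat.div_add_mod k p, padicCoeff_mul_add h _ (Nat.mod_lt _ hp.out.pos)]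
    exact mul_mem (ih _ (Nat.div_lt_self hk hp.out.one_lt) _) (digitFactor _ _ _ _ _).2

theorem one_div_mem_of_isUnit {x : ℤ_[p]} (hx : IsUnit x) :
    1 / (x : ℚ_[p]) ∈ PadicInt.subring p := by
  rw [PadicInt.mem_subring_iff, norm_div, norm_one, ← PadicInt.norm_def,
    PadicInt.isUnit_iff.mp hx, div_one]

theorem IsShift.exists_sum_range {x x' : ℤ_[p]} {c : ℕ} (h : IsShift x x' c) (r : ℕ) {u : ℕ}
    (hu : u < p) : ∃ e ∈ PadicInt.subring p,
    ∑ i ∈ range (p * r + u), 1 / ((x : ℚ_[p]) + i) =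
      e + ((∑ l ∈ range r, 1 / ((x' : ℚ_[p]) + l)) +
        if c < u then 1 / ((x' : ℚ_[p]) + r) else 0) / p := by
  refine ⟨∑ i ∈ range (p * r + u), if i % p = c then 0 else 1 / ((x : ℚ_[p]) + i), ?_, ?_⟩
  rotate_left
  · rw [sum_range_split_mod h.1 (fun i : ℕ => 1 / ((x : ℚ_[p]) + i)) r hu.le]
    congr 1
    have h1 : ∀ l : ℕ, 1 / ((x : ℚ_[p]) + ((p * l + c : ℕ) : ℚ_[p])) =
        1 / ((x' : ℚ_[p]) + l) / p := by
      intro l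
      have := congrArg (fun z : ℤ_[p] => (z : ℚ_[p])) (h.apply_add l)
      simp only [PadicInt.coe_add, PadicInt.coe_mul, PadicInt.coe_natCast] at this
      rw [this, div_div, mul_comm]
    simp only [h1, add_div, sum_div, ite_div, zero_div]
  · refine sum_mem fun i _ => ?_
    split_ifs with hi
    · exact zero_mem _
    · have := one_div_mem_of_isUnit ((h.isUnit_iff i).mpr hi)
      simpa using this

theorem exists_padicHarm {b b' : Fin n → ℤ_[p]} {c : Fin n → ℕ}
    (h : ∀ j, IsShift (b j) (b' j) (c j)) (r : ℕ) {u : ℕ} (hu : u < p) :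
    ∃ e ∈ PadicInt.subring p, p * padicHarm b (p * r + u) - padicHarm b' r =
      p * e + ∑ j, if c j < u then 1 / ((b' j : ℚ_[p]) + r) else 0 := by
  have hp0 : (p : ℚ_[p]) ≠ 0 := by exact_mod_cast hp.out.ne_zero
  choose e he hes using fun j => (h j).exists_sum_range r hu
  obtain ⟨e1, he1, hes1⟩ := (isShift_one (p := p)).exists_sum_range r hu
  rw [if_neg (by omega), add_zero, PadicInt.coe_one] at hes1
  refine ⟨∑ j, (e j - e1), sum_mem fun j _ => sub_mem (he j) he1, ?_⟩
  rw [padicHarm, padicHarm, mul_sum, mul_sum, ← sum_sub_distrib, ← sum_add_distrib]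
  refine sum_congr rfl fun j _ => ?_
  rw [sum_sub_distrib, sum_sub_distrib, hes j, hes1]
  field_simp
  ring

/-- Apart from `H_{b'}(r)` and multiples of `p`, the only terms in `p * H_b(p * r + u)` are
`1 / (b' j + r)` with `c j < u`, and `p * (b' j + r)` is a factor of `D_u(r)`. -/
theorem padicCoeff_mul_padicHarm_congr {b b' : Fin n → ℤ_[p]} {c : Fin n → ℕ}
    (h : ∀ j, IsShift (b j) (b' j) (c j)) (r : ℕ) {u : ℕ} (hu : u < p) :
    ∃ e ∈ PadicInt.subring p, padicCoeff b (p * r + u) *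
      (p * padicHarm b (p * r + u) - padicHarm b' r) = p * e := by
  obtain ⟨e, he, hes⟩ := exists_padicHarm h r hu
  have key : ∀ j, ∃ f ∈ PadicInt.subring p, padicCoeff b (p * r + u) *
      (if c j < u then 1 / ((b' j : ℚ_[p]) + r) else 0) = p * f := by
    intro j
    split_ifs with hj
    swap
    · exact ⟨0, zero_mem _, by simp⟩
    -- If `b' j + r = 0`, the junk value `1 / 0 = 0` makes the summand vanish.
    rcases eq_or_ne ((b' j : ℚ_[p]) + r) 0 with h0 | h0
    · exact ⟨0, zero_mem _, by simp [h0]⟩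
    have hd : (p : ℤ_[p]) * (b' j + r) ∣ digitFactor b b' c u r := by
      have h1 := dvd_prod_of_mem (fun j => unitRatio (b j) (p * r + u) *
        if c j < u then (p : ℤ_[p]) * (b' j + r) else 1) (mem_univ j)
      simp only [if_pos hj] at h1
      exact (dvd_mul_left _ _).trans h1
    obtain ⟨w, hw⟩ := hd
    refine ⟨padicCoeff b' r * w, mul_mem (padicCoeff_mem _ _) w.2, ?_⟩
    rw [padicCoeff_mul_add h r hu, hw]
    push_cast
    field_simp
  choose f hf hfs using key
  refine ⟨padicCoeff b (p * r + u) * e + ∑ j, f j,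
    add_mem (mul_mem (padicCoeff_mem _ _) he) (sum_mem fun j _ => hf j), ?_⟩
  rw [hes, mul_add, mul_sum]
  simp only [hfs]
  rw [mul_add, mul_sum]
  ring

end PadicCoefficients

/-! ### Dwork's congruence -/

section DworkCongruence

/-- Splitting a sum over `r + t = K` according to the lowest digits `w` of `r` and `t`; the remaining
parts have a sum `J`, which depends on the carry and is less than `K`. -/
theorem sum_antidiagonal_digits {M : Type*} [AddCommMonoid M] {p K : ℕ} (hp : 1 < p) (hK : 0 < K)
    (f : ℕ → ℕ → M) :
    ∑ x ∈ antidiagonal K, f x.1 x.2 = ∑ J ∈ range K, ∑ y ∈ antidiagonal J,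
      ∑ w ∈ range p ×ˢ range p with w.1 + w.2 + p * J = K,
        f (p * y.1 + w.1) (p * y.2 + w.2) := by
  have hp0 : 0 < p := by omega
  rw [sum_sigma', sum_sigma']
  symm
  refine sum_nbij' (fun z => (p * z.1.2.1 + z.2.1, p * z.1.2.2 + z.2.2))
    (fun x => ⟨⟨x.1 / p + x.2 / p, (x.1 / p, x.2 / p)⟩, (x.1 % p, x.2 % p)⟩) ?_ ?_ ?_ ?_ ?_
  · rintro ⟨⟨J, ⟨y1, y2⟩⟩, ⟨w1, w2⟩⟩ hz
    simp only [mem_sigma, mem_range, HasAntidiagonal.mem_antidiagonal, mem_filter, mem_product] at hz ⊢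
    obtain ⟨⟨_, h1⟩, _, h2⟩ := hz
    rw [← h2, ← h1]; ring
  · rintro ⟨x1, x2⟩ hx
    simp only [mem_sigma, mem_range, HasAntidiagonal.mem_antidiagonal, mem_filter, mem_product] at hx ⊢
    have h1 := Nat.div_add_mod x1 p
    have h2 := Nat.div_add_mod x2 p
    have h3 : x1 % p + x2 % p + p * (x1 / p + x2 / p) = K := by
      rw [← hx]; linarith
    refine ⟨⟨?_, trivial⟩, ⟨Nat.mod_lt _ hp0, Nat.mod_lt _ hp0⟩, h3⟩
    by_contra! h
    have := Nat.mul_le_mul hp h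
    omega
  · rintro ⟨⟨J, ⟨y1, y2⟩⟩, ⟨w1, w2⟩⟩ hz
    simp only [mem_sigma, mem_range, HasAntidiagonal.mem_antidiagonal, mem_filter, mem_product] at hz ⊢
    obtain ⟨⟨_, h1⟩, ⟨hw1, hw2⟩, h2⟩ := hz
    subst h1
    simp [Nat.mul_add_div hp0, Nat.div_eq_of_lt, hw1, hw2, Nat.mod_eq_of_lt]
  · rintro ⟨x1, x2⟩ _
    simp [Nat.div_add_mod]
  · intros; rfl

variable {p : ℕ} [hp : Fact p.Prime] {n : ℕ}

/-- A function of two natural numbers that extends to a `1`-Lipschitz function on `ℤ_[p] × ℤ_[p]`. -/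
def IsPadicLipschitz (η : ℕ → ℕ → ℤ_[p]) : Prop :=
  ∀ s r t r' t', r ≡ r' [MOD p ^ s] → t ≡ t' [MOD p ^ s] → (p : ℤ_[p]) ^ s ∣ η r t - η r' t'

/-- A function satisfying the Lipschitz congruences with one additional power of `p` is a constant plus
`p` times a `1`-Lipschitz function. -/
theorem exists_isPadicLipschitz_of_congr {E : ℕ → ℕ → ℤ_[p]}
    (hE : ∀ s r t r' t', r ≡ r' [MOD p ^ s] → t ≡ t' [MOD p ^ s] →
      (p : ℤ_[p]) ^ (s + 1) ∣ E r t - E r' t') :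
    ∃ η, IsPadicLipschitz η ∧ ∀ r t, E r t = E 0 0 + (p : ℤ_[p]) * η r t := by
  have h0 : ∀ r t, ∃ e, E r t = E 0 0 + (p : ℤ_[p]) * e := by
    intro r t
    obtain ⟨e, he⟩ := hE 0 r t 0 0 (by simp [Nat.modEq_one]) (by simp [Nat.modEq_one])
    exact ⟨e, by rw [zero_add, pow_one] at he; linear_combination he⟩
  choose η hη using h0
  refine ⟨η, fun s r t r' t' h1 h2 => ?_, hη⟩
  have h3 := hE s r t r' t' h1 h2
  rw [hη r t, hη r' t', pow_succ', show E 0 0 + p * η r t - (E 0 0 + p * η r' t') =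
    p * (η r t - η r' t') by ring] at h3
  exact (mul_dvd_mul_iff_left PadicInt.prime_p.ne_zero).mp h3

/-- The core of Dwork's congruence: antisymmetrizing a `1`-Lipschitz function cancels the denominators
of the harmonic sums. -/
theorem sum_padicHarm_mul_mem (K : ℕ) (b : Fin n → ℤ_[p]) {η : ℕ → ℕ → ℤ_[p]}
    (hη : IsPadicLipschitz η) :
    ∑ x ∈ antidiagonal K, padicHarm b x.1 * (padicCoeff b x.1 * padicCoeff b x.2) *
      ((η x.1 x.2 - η x.2 x.1 : ℤ_[p]) : ℚ_[p]) ∈ PadicInt.subring p := by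
  have hp0 : (p : ℚ_[p]) ≠ 0 := by exact_mod_cast hp.out.ne_zero
  induction K using Nat.strong_induction_on generalizing b η with
  | _ K ih =>
  rcases Nat.eq_zero_or_pos K with rfl | hK
  · simp
  choose b' c h using fun j => exists_isShift (b j)
  rw [sum_antidiagonal_digits hp.out.one_lt hK fun r t =>
    padicHarm b r * (padicCoeff b r * padicCoeff b t) * ((η r t - η t r : ℤ_[p]) : ℚ_[p])]
  refine sum_mem fun J hJ => ?_
  set W := {w ∈ range p ×ˢ range p | w.1 + w.2 + p * J = K} with hW
  have hWlt : ∀ w ∈ W, w.1 < p ∧ w.2 < p := by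
    intro w hw
    simpa using (mem_product.mp (mem_filter.mp hw).1)
  set D := digitFactor b b' c
  -- Summing over the lowest digits, `η` becomes the function `E`, which is constant modulo `p`.
  let E : ℕ → ℕ → ℤ_[p] := fun r t =>
    ∑ w ∈ W, D w.1 r * D w.2 t * η (p * r + w.1) (p * t + w.2)
  obtain ⟨η', hη', hE⟩ := exists_isPadicLipschitz_of_congr (E := E) (by
    intro s r t r' t' h1 h2
    have hlift : ∀ {a b : ℕ} (u : ℕ), a ≡ b [MOD p ^ s] →
        p * a + u ≡ p * b + u [MOD p ^ (s + 1)] := fun u hab => by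
      rw [pow_succ']
      exact Nat.ModEq.add_right u (Nat.ModEq.mul_left' p hab)
    rw [← sum_sub_distrib]
    exact dvd_sum fun w _ => dvd_mul_sub_mul
      (dvd_mul_sub_mul (digitFactor_congr _ _ _ _ h1) (digitFactor_congr _ _ _ _ h2))
      (hη _ _ _ _ _ (hlift _ h1) (hlift _ h2)))
  -- The set `W` of digit pairs is symmetric, so `E` is antisymmetrized in the same way as `η`.
  have hswap : ∀ r t, ∑ w ∈ W, D w.1 r * D w.2 t *
      (η (p * r + w.1) (p * t + w.2) - η (p * t + w.2) (p * r + w.1)) =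
        p * (η' r t - η' t r) := by
    intro r t
    have : E t r = ∑ w ∈ W, D w.1 r * D w.2 t * η (p * t + w.2) (p * r + w.1) := by
      refine sum_nbij' Prod.swap Prod.swap ?_ ?_ (by simp) (by simp) ?_
      · intro w hw
        simp only [hW, mem_filter, mem_product, mem_range, Prod.fst_swap, Prod.snd_swap] at hw ⊢
        omega
      · intro w hw
        simp only [hW, mem_filter, mem_product, mem_range, Prod.fst_swap, Prod.snd_swap] at hw ⊢
        omega
      · intro w _
        simp only [Prod.fst_swap, Prod.snd_swap]
        ring
    simp only [mul_sub, sum_sub_distrib]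
    rw [← this]
    linear_combination hE r t - hE t r
  -- Replacing `H_b(p r + w)` by `H_{b'}(r) / p` costs an integral error `e`.
  have hmain := ih J (mem_range.mp hJ) b' hη'
  have key : ∀ y ∈ antidiagonal J, ∃ e ∈ PadicInt.subring p,
      ∑ w ∈ W, padicHarm b (p * y.1 + w.1) *
        (padicCoeff b (p * y.1 + w.1) * padicCoeff b (p * y.2 + w.2)) *
        ((η (p * y.1 + w.1) (p * y.2 + w.2) - η (p * y.2 + w.2) (p * y.1 + w.1) : ℤ_[p]) : ℚ_[p])
      = e + padicHarm b' y.1 * (padicCoeff b' y.1 * padicCoeff b' y.2) *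
        ((η' y.1 y.2 - η' y.2 y.1 : ℤ_[p]) : ℚ_[p]) := by
    intro y _
    have hw : ∀ w : ℕ × ℕ, ∃ e ∈ PadicInt.subring p, w ∈ W → padicCoeff b (p * y.1 + w.1) *
      (p * padicHarm b (p * y.1 + w.1) - padicHarm b' y.1) = p * e := by
      intro w
      by_cases hw : w ∈ W
      · obtain ⟨e, he, h1⟩ := padicCoeff_mul_padicHarm_congr h y.1 (hWlt w hw).1
        exact ⟨e, he, fun _ => h1⟩
      · exact ⟨0, zero_mem _, fun h => absurd h hw⟩
    choose e he hes using hw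
    refine ⟨∑ w ∈ W, e w * padicCoeff b (p * y.2 + w.2) *
      ((η (p * y.1 + w.1) (p * y.2 + w.2) - η (p * y.2 + w.2) (p * y.1 + w.1) : ℤ_[p]) : ℚ_[p]),
      sum_mem fun w _ => mul_mem (mul_mem (he w) (padicCoeff_mem _ _)) (Subtype.prop _), ?_⟩
    have h1 := congrArg (fun z : ℤ_[p] => (z : ℚ_[p])) (hswap y.1 y.2)
    simp only [PadicInt.coe_sum, PadicInt.coe_mul, PadicInt.coe_natCast] at h1
    have h2 : ((η' y.1 y.2 - η' y.2 y.1 : ℤ_[p]) : ℚ_[p]) = (∑ w ∈ W, (D w.1 y.1 : ℚ_[p]) *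
        D w.2 y.2 * ((η (p * y.1 + w.1) (p * y.2 + w.2) -
          η (p * y.2 + w.2) (p * y.1 + w.1) : ℤ_[p]) : ℚ_[p])) / p := by
      rw [h1]; field_simp
    rw [h2, sum_div, mul_sum, ← sum_add_distrib]
    refine sum_congr rfl fun w hw => ?_
    have h3 := hes w hw
    have h4 := padicCoeff_mul_add h y.1 (hWlt w hw).1
    have h5 := padicCoeff_mul_add h y.2 (hWlt w hw).2
    have h6 : padicCoeff b (p * y.1 + w.1) * padicHarm b (p * y.1 + w.1) =
        e w + padicCoeff b (p * y.1 + w.1) * padicHarm b' y.1 / p := by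
      field_simp; linear_combination h3
    rw [mul_comm (padicHarm b _) _, mul_right_comm (padicCoeff b (p * y.1 + w.1)), h6, h4, h5]
    ring
  choose! e he hes using key
  rw [sum_congr rfl hes, sum_add_distrib]
  exact add_mem (sum_mem he) hmain

/-- **Dwork's congruence**: the coefficients of `G_{b'}(z^p) F_b(z) - p G_b(z) F_{b'}(z^p)` are
divisible by `p`. The sum is the coefficient of `z ^ (p * J + u)`. -/
theorem dwork_congruence {b b' : Fin n → ℤ_[p]} {c : Fin n → ℕ}
    (h : ∀ j, IsShift (b j) (b' j) (c j)) (J : ℕ) {u : ℕ} (hu : u < p) :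
    ∃ e ∈ PadicInt.subring p,
      ∑ y ∈ antidiagonal J,
        (padicCoeff b' y.1 * padicHarm b' y.1 * padicCoeff b (p * y.2 + u) -
          p * (padicCoeff b' y.1 * (padicCoeff b (p * y.2 + u) * padicHarm b (p * y.2 + u)))) =
        p * e := by
  obtain ⟨η, hη, hD⟩ := exists_isPadicLipschitz_of_congr
    (E := fun _ t => digitFactor b b' c u t) fun s _ _ _ _ _ h2 => digitFactor_congr b b' c u h2
  choose e he hes using fun r => padicCoeff_mul_padicHarm_congr h r hu
  refine ⟨∑ x ∈ antidiagonal J, padicHarm b' x.1 * (padicCoeff b' x.1 * padicCoeff b' x.2) *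
      ((η x.1 x.2 - η x.2 x.1 : ℤ_[p]) : ℚ_[p]) - ∑ y ∈ antidiagonal J, padicCoeff b' y.1 * e y.2,
    sub_mem (sum_padicHarm_mul_mem J b' hη)
      (sum_mem fun y _ => mul_mem (padicCoeff_mem _ _) (he _)), ?_⟩
  have hD' : ∀ r t, (digitFactor b b' c u t : ℚ_[p]) = digitFactor b b' c u 0 + p * η r t := by
    intro r t
    exact_mod_cast congrArg (fun z : ℤ_[p] => (z : ℚ_[p])) (hD r t)
  have hs : ∑ y ∈ antidiagonal J, padicHarm b' y.2 * (padicCoeff b' y.2 * padicCoeff b' y.1) *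
      digitFactor b b' c u y.2 = ∑ y ∈ antidiagonal J, padicHarm b' y.1 *
        (padicCoeff b' y.1 * padicCoeff b' y.2) * digitFactor b b' c u y.1 :=
    Nat.sum_antidiagonal_swap (f := fun y : ℕ × ℕ => padicHarm b' y.1 *
        (padicCoeff b' y.1 * padicCoeff b' y.2) * (digitFactor b b' c u y.1 : ℚ_[p]))
  have h1 : ∀ y : ℕ × ℕ, padicCoeff b' y.1 * padicHarm b' y.1 * padicCoeff b (p * y.2 + u) -
      p * (padicCoeff b' y.1 * (padicCoeff b (p * y.2 + u) * padicHarm b (p * y.2 + u))) =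
      padicHarm b' y.1 * (padicCoeff b' y.1 * padicCoeff b' y.2) * digitFactor b b' c u y.2 -
      padicHarm b' y.2 * (padicCoeff b' y.2 * padicCoeff b' y.1) * digitFactor b b' c u y.2 -
      p * (padicCoeff b' y.1 * e y.2) := by
    intro y
    have h3 := padicCoeff_mul_add h y.2 hu
    have h4 := hes y.2
    linear_combination (padicCoeff b' y.1 * padicHarm b' y.1 -
      padicCoeff b' y.1 * padicHarm b' y.2) * h3 - padicCoeff b' y.1 * h4
  simp only [h1, sum_sub_distrib]
  rw [hs, mul_sub, mul_sum, mul_sum, ← sum_sub_distrib]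
  congr 1
  refine sum_congr rfl fun y _ => ?_
  rw [hD' y.1 y.2, hD' y.2 y.1]
  push_cast
  ring

end DworkCongruence

/-! ### Exponentials of power series -/

section ExpSubst

open PowerSeries

variable {K : Type*} [Field K] [Algebra ℚ K]

/-- The power series `exp(f)`; only meaningful when `f` has zero constant term. -/
noncomputable def expSeries (f : K⟦X⟧) : K⟦X⟧ := (PowerSeries.exp K).subst f

theorem hasSubst_of_constantCoeff {K : Type*} [Field K] {f : K⟦X⟧}
    (hf : constantCoeff f = 0) : HasSubst f :=
  HasSubst.of_constantCoeff_zero' hf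

theorem constantCoeff_expSeries {f : K⟦X⟧} (hf : constantCoeff f = 0) :
    constantCoeff (expSeries f) = 1 := by
  have h := coeff_subst' (hasSubst_of_constantCoeff hf) (PowerSeries.exp K) 0
  rw [coeff_zero_eq_constantCoeff_apply, finsum_eq_single _ 0] at h
  · rw [expSeries, h]; simp
  · intro d hd
    simp [hf, hd]

theorem derivative_expSeries {f : K⟦X⟧} (hf : constantCoeff f = 0) :
    d⁄dX K (expSeries f) = expSeries f * d⁄dX K f := by
  rw [expSeries, derivative_subst (hasSubst_of_constantCoeff hf), derivative_exp]

theorem expSeries_add [CharZero K] {f g : K⟦X⟧} (hf : constantCoeff f = 0)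
    (hg : constantCoeff g = 0) : expSeries (f + g) = expSeries f * expSeries g := by
  have hneg : ∀ {f : K⟦X⟧}, constantCoeff f = 0 → expSeries f * expSeries (-f) = 1 := by
    intro f hf
    have hf' : constantCoeff (-f) = 0 := by simp [hf]
    refine derivative.ext ?_ ?_
    · rw [Derivation.leibniz, derivative_expSeries hf, derivative_expSeries hf', derivative_one]
      simp only [smul_eq_mul, map_neg]
      ring
    · simp [constantCoeff_expSeries hf, constantCoeff_expSeries hf']
  have hfg : constantCoeff (f + g) = 0 := by simp [hf, hg]
  have hf' : constantCoeff (-f) = 0 := by simp [hf]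
  have hg' : constantCoeff (-g) = 0 := by simp [hg]
  have h : expSeries (f + g) * (expSeries (-f) * expSeries (-g)) = 1 := by
    refine derivative.ext ?_ ?_
    · rw [Derivation.leibniz, Derivation.leibniz, derivative_expSeries hfg,
        derivative_expSeries hf', derivative_expSeries hg', derivative_one]
      simp only [smul_eq_mul, map_neg, map_add]
      ring
    · simp [constantCoeff_expSeries hfg, constantCoeff_expSeries hf', constantCoeff_expSeries hg']
  linear_combination (expSeries f * expSeries g) * h -
    expSeries (f + g) * (expSeries g * expSeries (-g)) * hneg hf - expSeries (f + g) * hneg hg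

theorem expSeries_natCast_mul [CharZero K] {f : K⟦X⟧} (hf : constantCoeff f = 0) (m : ℕ) :
    expSeries ((m : K⟦X⟧) * f) = expSeries f ^ m := by
  induction m with
  | zero =>
    rw [Nat.cast_zero, zero_mul, pow_zero, expSeries, subst_zero_eq_C_constantCoeff]
    simp
  | succ m ih =>
    have : constantCoeff ((m : K⟦X⟧) * f) = 0 := by simp [hf]
    rw [Nat.cast_succ, add_mul, one_mul, expSeries_add this hf, ih, pow_succ]

theorem expand_expSeries {f : K⟦X⟧} (hf : constantCoeff f = 0) {p : ℕ} (hp : p ≠ 0) :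
    expand p hp (expSeries f) = expSeries (expand p hp f) :=
  expand_subst p hp (hasSubst_of_constantCoeff hf) _

theorem rescale_expSeries {f : K⟦X⟧} (hf : constantCoeff f = 0) (r : K) :
    rescale r (expSeries f) = expSeries (rescale r f) := by
  rw [expSeries, expSeries, rescale_eq_subst, rescale_eq_subst,
    subst_comp_subst_apply (hasSubst_of_constantCoeff hf) (HasSubst.smul_X' r)]

theorem map_expSeries {L : Type*} [Field L] [Algebra ℚ L] (φ : K →+* L) {f : K⟦X⟧}
    (hf : constantCoeff f = 0) : PowerSeries.map φ (expSeries f) =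
      expSeries (PowerSeries.map φ f) := by
  have := map_subst (h := φ) (hasSubst_of_constantCoeff hf) (PowerSeries.exp K)
  rw [map_exp] at this
  exact this

end ExpSubst

/-! ### The Dieudonné–Dwork criterion -/

section DieudonneDwork

open PowerSeries

variable {p : ℕ} [hp : Fact p.Prime]

variable (p) in
/-- The subring of power series over `ℚ_[p]` with coefficients in `ℤ_[p]`. -/
noncomputable def integralSeries : Subring ℚ_[p]⟦X⟧ :=
  (PowerSeries.map (PadicInt.Coe.ringHom (p := p))).range

theorem mem_integralSeries {f : ℚ_[p]⟦X⟧} :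
    f ∈ integralSeries p ↔ ∀ k, coeff k f ∈ PadicInt.subring p := by
  constructor
  · rintro ⟨g, rfl⟩ k
    rw [coeff_map]
    exact (coeff k g).2
  · intro h
    have h' : ∀ k, ∃ g : ℤ_[p], PadicInt.Coe.ringHom g = coeff k f := fun k => ⟨⟨_, h k⟩, rfl⟩
    choose g hg using h'
    refine ⟨PowerSeries.mk g, ?_⟩
    ext k
    rw [coeff_map, coeff_mk, hg]

/-- The number `p ^ d / d!` is divisible by `p` for `d ≥ 1`, also when `p = 2`. -/
theorem pow_div_factorial_mem {d : ℕ} (hd : d ≠ 0) :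
    ∃ e ∈ PadicInt.subring p, (p : ℚ_[p]) ^ d * (1 / (d.factorial : ℚ_[p])) = p * e := by
  have hd0 : (d.factorial : ℚ_[p]) ≠ 0 := by exact_mod_cast d.factorial_ne_zero
  refine ⟨(p : ℚ_[p]) ^ (d - 1) / d.factorial, ?_, ?_⟩
  · have h := padicValNat_factorial_lt_of_ne_zero p hd
    rw [PadicInt.mem_subring_iff, norm_div, norm_pow, Padic.norm_p,
      Padic.norm_eq_zpow_neg_valuation hd0, Padic.valuation_natCast, zpow_neg, inv_pow,
      zpow_natCast, div_inv_eq_mul, inv_mul_le_one₀ (by have := hp.out.pos; positivity)]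
    exact pow_le_pow_right₀ (by exact_mod_cast hp.out.one_lt.le) (by omega)
  · obtain ⟨m, rfl⟩ := Nat.exists_eq_succ_of_ne_zero hd
    rw [Nat.succ_sub_one, Nat.succ_eq_add_one, pow_succ]
    ring

theorem exists_expSeries_mul {h : ℚ_[p]⟦X⟧} (hh : h ∈ integralSeries p)
    (h0 : constantCoeff h = 0) :
    ∃ w ∈ integralSeries p, expSeries ((p : ℚ_[p]⟦X⟧) * h) = 1 + (p : ℚ_[p]⟦X⟧) * w := by
  have hph : constantCoeff ((p : ℚ_[p]⟦X⟧) * h) = 0 := by simp [h0]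
  have hs := hasSubst_of_constantCoeff hph
  have key : ∀ k, ∃ e ∈ PadicInt.subring p,
      coeff k (expSeries ((p : ℚ_[p]⟦X⟧) * h) - 1) = p * e := by
    intro k
    have h1 : expSeries ((p : ℚ_[p]⟦X⟧) * h) - 1 =
        (PowerSeries.exp ℚ_[p] - 1).subst ((p : ℚ_[p]⟦X⟧) * h) := by
      rw [subst_sub hs, ← coe_substAlgHom hs, map_one, coe_substAlgHom hs, expSeries]
    rw [h1, coeff_subst' hs]
    refine finsum_induction (fun x => ∃ e ∈ PadicInt.subring p, x = p * e)
      ⟨0, zero_mem _, by simp⟩ ?_ fun d => ?_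
    · rintro _ _ ⟨e, he, rfl⟩ ⟨e', he', rfl⟩
      exact ⟨e + e', add_mem he he', by ring⟩
    · rcases eq_or_ne d 0 with rfl | hd
      · exact ⟨0, zero_mem _, by simp⟩
      · obtain ⟨e, he, hes⟩ := pow_div_factorial_mem (p := p) hd
        refine ⟨e * coeff k (h ^ d), mul_mem he (mem_integralSeries.mp (pow_mem hh d) k), ?_⟩
        rw [mul_pow, ← Nat.cast_pow, ← map_natCast (C (R := ℚ_[p])), coeff_C_mul, map_sub, coeff_exp,
          coeff_one, if_neg hd, sub_zero, smul_eq_mul, ← mul_assoc, ← mul_assoc, ← hes]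
        congr 1
        push_cast
        simp [mul_comm]
  choose e he hes using key
  refine ⟨PowerSeries.mk e, mem_integralSeries.mpr fun k => by rw [coeff_mk]; exact he k, ?_⟩
  ext k
  have := hes k
  rw [map_sub] at this
  rw [map_add, ← map_natCast (C (R := ℚ_[p])), coeff_C_mul, coeff_mk, ← this]
  simp

/-- The Frobenius congruence `q(z)^p ≡ q(z^p)` modulo `p`. -/
theorem exists_pow_eq_expand_add (q : ℤ_[p]⟦X⟧) :
    ∃ w : ℤ_[p]⟦X⟧, q ^ p = expand p hp.out.ne_zero q + (p : ℤ_[p]⟦X⟧) * w := by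
  have h1 : PowerSeries.map (PadicInt.toZMod (p := p)) (q ^ p - expand p hp.out.ne_zero q) = 0 := by
    have h2 := MvPowerSeries.map_frobenius_expand (R := ZMod p) (σ := Unit) p hp.out.ne_zero
      (f := PowerSeries.map (PadicInt.toZMod (p := p)) q)
    rw [ZMod.frobenius_zmod, MvPowerSeries.map_id] at h2
    rw [map_sub, map_pow, map_expand, sub_eq_zero]
    exact h2.symm
  have h3 : ∀ k, ∃ w, coeff k (q ^ p - expand p hp.out.ne_zero q) = (p : ℤ_[p]) * w := by
    intro k
    have h4 := congrArg (coeff k) h1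
    rw [coeff_map, map_zero, ← RingHom.mem_ker, PadicInt.ker_toZMod,
      PadicInt.maximalIdeal_eq_span_p, Ideal.mem_span_singleton] at h4
    exact h4
  choose w hw using h3
  refine ⟨PowerSeries.mk w, ?_⟩
  rw [← sub_eq_iff_eq_add']
  ext k
  rw [hw, ← map_natCast (C (R := ℤ_[p])), coeff_C_mul, coeff_mk]

/-- The equation `y(z)^p = y(z^p) (1 + p w(z))` with `w` integral forces `y` to be integral: the
coefficient of `z ^ k` on the left is `p` times that of `y` plus terms in lower coefficients, which
agree with those on the right modulo `p` by the Frobenius congruence. -/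
theorem mem_integralSeries_of_pow_eq {y w : ℚ_[p]⟦X⟧} (h0 : constantCoeff y = 1)
    (hw : w ∈ integralSeries p)
    (hy : y ^ p = expand p hp.out.ne_zero y * (1 + (p : ℚ_[p]⟦X⟧) * w)) :
    y ∈ integralSeries p := by
  have hp0 : (p : ℚ_[p]) ≠ 0 := by exact_mod_cast hp.out.ne_zero
  rw [mem_integralSeries] at hw ⊢
  intro k
  induction k using Nat.strong_induction_on with
  | _ k ih =>
  rcases Nat.eq_zero_or_pos k with rfl | hk
  · rw [coeff_zero_eq_constantCoeff_apply, h0]; exact one_mem _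
  -- `Q` is the truncation of `y`, integral by induction, and `y = Q + X ^ k * z`.
  set Q : ℚ_[p]⟦X⟧ := PowerSeries.mk fun j => if j < k then coeff j y else 0 with hQdef
  have hQc : ∀ j, j < k → coeff j Q = coeff j y := by
    intro j hj
    rw [hQdef, coeff_mk, if_pos hj]
  have hQm : Q ∈ integralSeries p := by
    refine mem_integralSeries.mpr fun j => ?_
    rw [hQdef, coeff_mk]
    split_ifs with hj
    · exact ih j hj
    · exact zero_mem _
  obtain ⟨q, hQ⟩ := hQm
  have hdvd : X ^ k ∣ y - Q := by
    rw [X_pow_dvd_iff]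
    intro j hj
    rw [map_sub, hQc j hj, sub_self]
  obtain ⟨z, hz⟩ := hdvd
  have hzk : coeff k y = constantCoeff z := by
    have h1 := congrArg (coeff k) hz
    have h2 : coeff k Q = 0 := by
      rw [hQdef, coeff_mk, if_neg (lt_irrefl k)]
    rw [map_sub, h2, sub_zero, coeff_X_pow_mul', if_pos le_rfl, Nat.sub_self,
      coeff_zero_eq_constantCoeff_apply] at h1
    exact h1
  have hQ0 : constantCoeff Q = 1 := by
    rw [← coeff_zero_eq_constantCoeff_apply, hQc 0 hk, coeff_zero_eq_constantCoeff_apply, h0]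
  obtain ⟨r, hr⟩ := Polynomial.powAddExpansion Q (X ^ k * z) p
  have hyp : coeff k (y ^ p) = coeff k (Q ^ p) + p * coeff k y := by
    have e1 : y ^ p = Q ^ p + X ^ k * (C (p : ℚ_[p]) * (Q ^ (p - 1) * z) + X ^ k * (r * z ^ 2)) := by
      rw [show y = Q + X ^ k * z by rw [← hz]; ring, hr, map_natCast]; ring
    rw [e1, map_add, coeff_X_pow_mul', if_pos le_rfl, Nat.sub_self,
      coeff_zero_eq_constantCoeff_apply, hzk]
    simp [hQ0, hk.ne']
  obtain ⟨v, hv⟩ := exists_pow_eq_expand_add q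
  have hv' := congrArg (PowerSeries.map (PadicInt.Coe.ringHom (p := p))) hv
  rw [map_pow, map_add, map_mul, map_expand, map_natCast, hQ] at hv'
  have hdiv : ∀ i, i ≤ k → i / p < k := fun i hi =>
    (Nat.div_le_div_right hi).trans_lt (Nat.div_lt_self hk hp.out.one_lt)
  have hexp : coeff k (expand p hp.out.ne_zero Q) = coeff k (expand p hp.out.ne_zero y) := by
    rw [coeff_expand, coeff_expand, hQc _ (hdiv k le_rfl)]
  have hmem : coeff k (expand p hp.out.ne_zero y * w) ∈ PadicInt.subring p := by
    rw [coeff_mul]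
    refine sum_mem fun ij hij => mul_mem ?_ (hw _)
    have : ij.1 ≤ k := by
      have := HasAntidiagonal.mem_antidiagonal.mp hij; omega
    rw [coeff_expand]
    split_ifs
    · exact ih _ (hdiv _ this)
    · exact zero_mem _
  have hfin : coeff k y = coeff k (expand p hp.out.ne_zero y * w) -
      ((coeff k v : ℤ_[p]) : ℚ_[p]) := by
    have h1 := congrArg (coeff k) hy
    have h2 := congrArg (coeff k) hv'
    rw [hyp, h2, mul_add, mul_one, map_add, map_add, hexp,
      show expand p hp.out.ne_zero y * ((p : ℚ_[p]⟦X⟧) * w) =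
        C (p : ℚ_[p]) * (expand p hp.out.ne_zero y * w) by rw [map_natCast]; ring,
      coeff_C_mul, ← map_natCast (C (R := ℚ_[p])), coeff_C_mul, coeff_map] at h1
    refine mul_left_cancel₀ hp0 ?_
    change _ + (p : ℚ_[p]) * ((coeff k v : ℤ_[p]) : ℚ_[p]) + _ = _ at h1
    linear_combination h1
  rw [hfin]
  exact sub_mem hmem (Subtype.prop _)

/-- The **Dieudonné–Dwork criterion**, in the direction from `f(z^p) - p f(z) ∈ p ℤ_[p]⟦z⟧` to the
integrality of `exp f`. -/
theorem expSeries_mem_integralSeries {f h : ℚ_[p]⟦X⟧} (hf : constantCoeff f = 0)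
    (hh : h ∈ integralSeries p)
    (hfh : expand p hp.out.ne_zero f - (p : ℚ_[p]⟦X⟧) * f = (p : ℚ_[p]⟦X⟧) * h) :
    expSeries f ∈ integralSeries p := by
  have hp0 : (p : ℚ_[p]) ≠ 0 := by exact_mod_cast hp.out.ne_zero
  have h0 : constantCoeff h = 0 := by
    have := congrArg (constantCoeff (R := ℚ_[p])) hfh
    simpa [hf, hp0] using this
  obtain ⟨w, hw, hws⟩ := exists_expSeries_mul (neg_mem hh) (by simp [h0] : constantCoeff (-h) = 0)
  refine mem_integralSeries_of_pow_eq (constantCoeff_expSeries hf) hw ?_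
  rw [← hws, expand_expSeries hf, ← expSeries_add (by simp [hf]) (by simp [h0]),
    ← expSeries_natCast_mul hf]
  congr 1
  linear_combination -hfh

end DieudonneDwork

/-! ### Euler's transformation for `n = 2` -/

section Reflection

open PowerSeries

/-- The Euler operator `θ = z d/dz` on formal power series. -/
noncomputable def euler (f : ℚ⟦X⟧) : ℚ⟦X⟧ := X * d⁄dX ℚ f

theorem coeff_euler (f : ℚ⟦X⟧) (k : ℕ) : coeff k (euler f) = k * coeff k f := by
  cases k with
  | zero => simp [euler]
  | succ k => rw [euler, coeff_succ_X_mul, coeff_derivative]; push_cast; ring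

theorem constantCoeff_euler (f : ℚ⟦X⟧) : constantCoeff (euler f) = 0 := by simp [euler]

theorem euler_add (f g : ℚ⟦X⟧) : euler (f + g) = euler f + euler g := by
  rw [euler, map_add, mul_add]; rfl

theorem euler_sub (f g : ℚ⟦X⟧) : euler (f - g) = euler f - euler g := by
  rw [euler, map_sub, mul_sub]; rfl

theorem euler_mul (f g : ℚ⟦X⟧) : euler (f * g) = f * euler g + g * euler f := by
  rw [euler, Derivation.leibniz, euler, euler, smul_eq_mul, smul_eq_mul]; ring

theorem euler_X : euler X = X := by rw [euler, derivative_X, mul_one]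

theorem euler_C (c : ℚ) : euler (C c) = 0 := by rw [euler, derivative_C, mul_zero]

theorem euler_one : euler 1 = 0 := by rw [euler, derivative_one, mul_zero]

theorem eq_of_euler_eq {f g : ℚ⟦X⟧} (h : euler f = euler g)
    (h0 : constantCoeff f = constantCoeff g) : f = g :=
  derivative.ext (mul_left_cancel₀ X_ne_zero h) h0

theorem coeff_succ_one_sub_X_mul (f : ℚ⟦X⟧) (k : ℕ) :
    coeff (k + 1) ((1 - X) * f) = coeff (k + 1) f - coeff k f := by
  rw [sub_mul, one_mul, map_sub, coeff_succ_X_mul]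

/-- A solution of the first-order equation `(1 - z) θ w = c z w` is determined by its constant
term; it is a multiple of `(1 - z) ^ (-c)`. -/
theorem eq_of_firstOrder {c : ℚ} {v w : ℚ⟦X⟧} (hv : (1 - X) * euler v = X * (C c * v))
    (hw : (1 - X) * euler w = X * (C c * w)) (h0 : constantCoeff v = constantCoeff w) : v = w := by
  ext k
  induction k with
  | zero => simpa using h0
  | succ k ih =>
    have h1 := congrArg (coeff (k + 1)) hv
    have h2 := congrArg (coeff (k + 1)) hw
    rw [coeff_succ_one_sub_X_mul, coeff_succ_X_mul, coeff_euler, coeff_euler, coeff_C_mul] at h1 h2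
    have h3 : ((k + 1 : ℕ) : ℚ) ≠ 0 := by positivity
    refine mul_left_cancel₀ h3 ?_
    linear_combination h1 - h2 + (c + k) * ih

/-- A power series solution of the hypergeometric equation `θ² - z (θ² + s θ + t)` is determined by
its constant term. -/
theorem eq_of_secondOrder {s t : ℚ} {v w : ℚ⟦X⟧}
    (hv : (1 - X) * euler (euler v) = X * (C s * euler v + C t * v))
    (hw : (1 - X) * euler (euler w) = X * (C s * euler w + C t * w))
    (h0 : constantCoeff v = constantCoeff w) : v = w := by
  ext k
  induction k with
  | zero => simpa using h0
  | succ k ih =>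
    have h1 := congrArg (coeff (k + 1)) hv
    have h2 := congrArg (coeff (k + 1)) hw
    rw [coeff_succ_one_sub_X_mul, coeff_succ_X_mul, map_add, coeff_C_mul, coeff_C_mul] at h1 h2
    simp only [coeff_euler] at h1 h2
    have h3 : ((k + 1 : ℕ) : ℚ) ≠ 0 := by positivity
    refine mul_left_cancel₀ h3 (mul_left_cancel₀ h3 ?_)
    linear_combination h1 - h2 + (k * k + s * k + t) * ih

/-- The binomial series `(1 - z) ^ (-c)`. -/
theorem exists_firstOrder (c : ℚ) :
    ∃ φ : ℚ⟦X⟧, (1 - X) * euler φ = X * (C c * φ) ∧ constantCoeff φ = 1 := by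
  refine ⟨PowerSeries.mk fun k => ∏ i ∈ range k, (c + i) / (i + 1), ?_, ?_⟩
  · ext k
    cases k with
    | zero => simp [euler]
    | succ k =>
      rw [coeff_succ_one_sub_X_mul, coeff_succ_X_mul, coeff_euler, coeff_euler, coeff_C_mul,
        coeff_mk, coeff_mk, prod_range_succ]
      have : (k : ℚ) + 1 ≠ 0 := by positivity
      push_cast
      field_simp
      ring
  · rw [← coeff_zero_eq_constantCoeff_apply, coeff_mk, prod_range_zero]

/-- The ratio `G / F` of the two normalized solutions of the hypergeometric equation
`θ² - z (θ² + s θ + t)` is unchanged under `(s, t) ↦ (2 - s, 1 - s + t)`. -/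
theorem ratio_eq_of_reflection {s t : ℚ} {F G F' G' : ℚ⟦X⟧}
    (hF : (1 - X) * euler (euler F) = X * (C s * euler F + C t * F))
    (hG : (1 - X) * euler (euler G) = X * (C s * euler G + C t * G) +
      (X * (2 * euler F + C s * F) - 2 * euler F))
    (hF' : (1 - X) * euler (euler F') = X * (C (2 - s) * euler F' + C (1 - s + t) * F'))
    (hG' : (1 - X) * euler (euler G') = X * (C (2 - s) * euler G' + C (1 - s + t) * G') +
      (X * (2 * euler F' + C (2 - s) * F') - 2 * euler F'))
    (hF0 : constantCoeff F = 1) (hF0' : constantCoeff F' = 1)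
    (hG0 : constantCoeff G = 0) (hG0' : constantCoeff G' = 0) :
    G * F⁻¹ = G' * F'⁻¹ := by
  have h1X : (1 - X : ℚ⟦X⟧) ≠ 0 := fun h => by simpa using congrArg (constantCoeff (R := ℚ)) h
  have hC2 : (C (2 : ℚ) : ℚ⟦X⟧) = 2 := map_ofNat _ 2
  rw [map_add, map_sub, map_sub, map_one, hC2] at hF'
  rw [map_add, map_sub, map_sub, map_one, hC2] at hG'
  obtain ⟨φ, hφ, hφ0⟩ := exists_firstOrder (s - 1)
  rw [map_sub, map_one] at hφ
  have hφ2 := congrArg euler hφ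
  simp only [euler_mul, euler_sub, euler_one, euler_X, euler_C] at hφ2
  -- Euler's transformation: `φ = (1 - z) ^ (1 - s)` intertwines the two equations.
  have hFF : F = φ * F' := by
    refine eq_of_secondOrder hF (mul_left_cancel₀ h1X ?_) (by simp [hF0, hF0', hφ0])
    simp only [euler_mul, euler_add]
    linear_combination (1 - X) * F' * hφ2 + C s * X * F' * hφ + 2 * (1 - X) * euler F' * hφ +
      (1 - X) * φ * hF' - X * C s * F' * hφ
  -- Both sides solve the equation of the Wronskian, `(1 - z) θ w = s z w`.
  have hW : F * euler G - G * euler F + F ^ 2 =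
      φ ^ 2 * (F' * euler G' - G' * euler F' + F' ^ 2) := by
    refine eq_of_firstOrder (c := s) ?_ ?_ (by
      simp [hF0, hF0', hG0, hG0', hφ0, constantCoeff_euler])
    · simp only [euler_mul, euler_add, euler_sub, pow_two]
      linear_combination F * hG - G * hF
    · simp only [euler_mul, euler_add, euler_sub, pow_two]
      linear_combination φ ^ 2 * (F' * hG' - G' * hF') +
        2 * φ * (F' * euler G' - G' * euler F' + F' ^ 2) * hφ
  have hne : F ≠ 0 := fun h => by simp [h] at hF0
  have hne' : F' ≠ 0 := fun h => by simp [h] at hF0'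
  have hG1 : G = (G * F⁻¹) * F := by
    rw [mul_assoc, PowerSeries.inv_mul_cancel _ (by simp [hF0]), mul_one]
  have hG1' : G' = (G' * F'⁻¹) * F' := by
    rw [mul_assoc, PowerSeries.inv_mul_cancel _ (by simp [hF0']), mul_one]
  have h0 : constantCoeff (G * F⁻¹) = constantCoeff (G' * F'⁻¹) := by simp [hG0, hG0']
  generalize G * F⁻¹ = f at *
  generalize G' * F'⁻¹ = f' at *
  refine eq_of_euler_eq (mul_left_cancel₀ (pow_ne_zero 2 hne) ?_) h0
  rw [hG1, hG1', euler_mul, euler_mul] at hW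
  linear_combination hW + (F' * φ + F) * (-1 - euler f') * hFF

theorem hypCoeff_succ {n : ℕ} (a : Fin n → ℚ) (k : ℕ) :
    hypCoeff a (k + 1) * ((k : ℚ) + 1) ^ n = hypCoeff a k * ∏ j, (a j + k) := by
  simp only [hypCoeff, ascPochhammer_succ_eval, prod_mul_distrib, Nat.factorial_succ]
  push_cast
  rw [mul_pow]
  field_simp

/-- The hypergeometric equation. -/
theorem euler_hypF (a : Fin 2 → ℚ) : (1 - X) * euler (euler (hypF a)) =
    X * (C (a 0 + a 1) * euler (hypF a) + C (a 0 * a 1) * hypF a) := by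
  ext k
  cases k with
  | zero => simp [euler]
  | succ k =>
    have h := hypCoeff_succ a k
    rw [Fin.prod_univ_two] at h
    rw [coeff_succ_one_sub_X_mul, coeff_succ_X_mul, map_add, coeff_C_mul, coeff_C_mul]
    simp only [coeff_euler, hypF, coeff_mk]
    push_cast
    linear_combination h

/-- The inhomogeneous equation for `G`, equivalent to `G + F log z` solving the hypergeometric
equation. -/
theorem euler_hypG (a : Fin 2 → ℚ) (ha : ∀ i, 0 < a i) : (1 - X) * euler (euler (hypG a)) =
    X * (C (a 0 + a 1) * euler (hypG a) + C (a 0 * a 1) * hypG a) +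
      (X * (2 * euler (hypF a) + C (a 0 + a 1) * hypF a) - 2 * euler (hypF a)) := by
  have hC2 : (2 : ℚ⟦X⟧) = C (2 : ℚ) := (map_ofNat _ 2).symm
  rw [hC2]
  ext k
  cases k with
  | zero => simp [euler]
  | succ k =>
    have h := hypCoeff_succ a k
    rw [Fin.prod_univ_two] at h
    rw [coeff_succ_one_sub_X_mul, map_add, map_sub, coeff_succ_X_mul, coeff_succ_X_mul,
      map_add (coeff k), map_add (coeff k), coeff_C_mul, coeff_C_mul, coeff_C_mul, coeff_C_mul, coeff_C_mul]
    simp only [coeff_euler, hypF, hypG, coeff_mk, Fin.sum_univ_two, sum_range_succ]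
    have h0 : a 0 + (k : ℚ) ≠ 0 := by have := ha 0; positivity
    have h1 : a 1 + (k : ℚ) ≠ 0 := by have := ha 1; positivity
    have e0 : 1 / (a 0 + (k : ℚ)) * (a 0 + k) = 1 := by field_simp
    have e1 : 1 / (a 1 + (k : ℚ)) * (a 1 + k) = 1 := by field_simp
    have e2 : 1 / (1 + (k : ℚ)) * (1 + k) = 1 := by field_simp
    push_cast
    generalize ∑ x ∈ range k, (1 / (a 0 + (x : ℚ)) - 1 / (1 + (x : ℚ))) = S at *
    generalize ∑ x ∈ range k, (1 / (a 1 + (x : ℚ)) - 1 / (1 + (x : ℚ))) = T at *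
    generalize 1 / (a 0 + (k : ℚ)) = u at *
    generalize 1 / (a 1 + (k : ℚ)) = v at *
    generalize 1 / (1 + (k : ℚ)) = w at *
    linear_combination (S + T + u + v - 2 * w) * h + hypCoeff a k * (a 1 + k) * e0 +
      hypCoeff a k * (a 0 + k) * e1 - 2 * hypCoeff a (k + 1) * (k + 1) * e2 + 2 * w * h

theorem constantCoeff_hypG {n : ℕ} (a : Fin n → ℚ) : constantCoeff (hypG a) = 0 := by
  simp [hypG, ← coeff_zero_eq_constantCoeff_apply]

/-- For `n = 2` the mirror map of `1 - a` equals that of `a`. -/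
theorem ratio_reflection (a : Fin 2 → ℚ) (ha : ∀ i, 0 < a i ∧ a i < 1) :
    hypG a * (hypF a)⁻¹ = hypG (fun i => 1 - a i) * (hypF fun i => 1 - a i)⁻¹ := by
  have hF' := euler_hypF fun i => 1 - a i
  have hG' := euler_hypG (fun i => 1 - a i) fun i => by linarith [(ha i).2]
  have h1 : 1 - a 0 + (1 - a 1) = 2 - (a 0 + a 1) := by ring
  have h2 : (1 - a 0) * (1 - a 1) = 1 - (a 0 + a 1) + a 0 * a 1 := by ring
  rw [h1, h2] at hF' hG'
  exact ratio_eq_of_reflection (euler_hypF a) (euler_hypG a fun i => (ha i).1) hF' hG'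
    (constantCoeff_hypF a) (constantCoeff_hypF _) (constantCoeff_hypG a) (constantCoeff_hypG _)

end Reflection

/-! ### Good primes -/

section GoodPrimes

open PowerSeries

theorem coeff_expand_mul_eq_sum {R : Type*} [CommRing R] {p : ℕ} (hp : p ≠ 0) (φ ψ : R⟦X⟧) (k : ℕ) :
    coeff k (expand p hp φ * ψ) =
      ∑ y ∈ antidiagonal (k / p), coeff y.1 φ * coeff (p * y.2 + k % p) ψ := by
  have hp0 := Nat.pos_of_ne_zero hp
  rw [coeff_mul]
  symm
  refine sum_of_injOn (fun y => (p * y.1, p * y.2 + k % p)) ?_ ?_ ?_ ?_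
  · rintro ⟨y1, y2⟩ _ ⟨z1, z2⟩ _ h
    simpa [hp] using h
  · rintro ⟨y1, y2⟩ hy
    have hy' : y1 + y2 = k / p := by simpa using hy
    have : p * y1 + (p * y2 + k % p) = k := by
      rw [← add_assoc, ← mul_add, hy', Nat.div_add_mod]
    simpa using this
  · rintro ⟨i, j⟩ hij hni
    have hij' : i + j = k := by simpa using hij
    rw [coeff_expand]
    split_ifs with hd
    · obtain ⟨y, rfl⟩ := hd
      refine absurd ⟨(y, j / p), ?_, ?_⟩ hni
      · simp only [mem_coe, HasAntidiagonal.mem_antidiagonal]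
        rw [← hij', Nat.mul_add_div hp0]
      · simp only [Prod.mk.injEq, true_and]
        rw [← hij', Nat.mul_add_mod, Nat.div_add_mod]
    · simp
  · rintro ⟨y1, y2⟩ _
    simp

variable {p : ℕ} [hp : Fact p.Prime] {n : ℕ}

theorem inv_mem_integralSeries {f : ℚ_[p]⟦X⟧} (hf : f ∈ integralSeries p)
    (h0 : constantCoeff f = 1) : f⁻¹ ∈ integralSeries p := by
  obtain ⟨g, hg⟩ := hf
  have hg0 : constantCoeff g = ((1 : ℤ_[p]ˣ) : ℤ_[p]) := by
    have h1 : ((constantCoeff g : ℤ_[p]) : ℚ_[p]) = 1 := by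
      rw [← h0, ← hg]
      simp only [← coeff_zero_eq_constantCoeff_apply, coeff_map]
      rfl
    exact PadicInt.ext (by simpa using h1)
  refine ⟨invOfUnit g 1, ?_⟩
  rw [PowerSeries.eq_inv_iff_mul_eq_one (by simp [h0]), ← hg, ← map_mul, mul_comm,
    mul_invOfUnit g 1 hg0, map_one]

/-- Divisibility by `p` of an integral power series can be tested on coefficients. -/
theorem natCast_mul_mem_iff (f : ℚ_[p]⟦X⟧) :
    (∃ h ∈ integralSeries p, f = (p : ℚ_[p]⟦X⟧) * h) ↔
      ∀ k, ∃ e ∈ PadicInt.subring p, coeff k f = p * e := by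
  constructor
  · rintro ⟨h, hh, rfl⟩ k
    refine ⟨_, mem_integralSeries.mp hh k, ?_⟩
    rw [← map_natCast (C (R := ℚ_[p])), coeff_C_mul]
  · intro h
    choose e he hes using h
    refine ⟨PowerSeries.mk e, mem_integralSeries.mpr fun k => by rw [coeff_mk]; exact he k, ?_⟩
    ext k
    rw [← map_natCast (C (R := ℚ_[p])), coeff_C_mul, coeff_mk, hes]

theorem norm_ratCast_le_one_iff (x : ℚ) : ‖(x : ℚ_[p])‖ ≤ 1 ↔ ¬ p ∣ x.den := by
  refine ⟨fun h hd => ?_, Padic.norm_rat_le_one⟩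
  have h1 := PadicInt.isUnit_iff.mp (PadicInt.isUnit_den x h)
  have h2 := (PadicInt.norm_natCast_lt_one_iff (p := p)).mpr hd
  exact absurd h1 h2.ne

theorem pIntegral_iff (f : ℚ⟦X⟧) :
    PIntegral p f ↔ PowerSeries.map (Rat.castHom ℚ_[p]) f ∈ integralSeries p := by
  rw [mem_integralSeries]
  refine forall_congr' fun k => ?_
  rw [coeff_map, PadicInt.mem_subring_iff, Rat.coe_castHom, norm_ratCast_le_one_iff]

theorem ascPochhammer_eval_eq_prod_range (x : ℚ) (k : ℕ) :
    (ascPochhammer ℚ k).eval x = ∏ i ∈ range k, (x + i) := by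
  induction k with
  | zero => simp
  | succ k ih => rw [ascPochhammer_succ_eval, ih, prod_range_succ]

theorem map_hypF {a : Fin n → ℚ} {b : Fin n → ℤ_[p]} (hb : ∀ j, (b j : ℚ_[p]) = a j) :
    PowerSeries.map (Rat.castHom ℚ_[p]) (hypF a) = PowerSeries.mk (padicCoeff b) := by
  ext k
  rw [coeff_map, hypF, coeff_mk, coeff_mk, hypCoeff, padicCoeff, prod_div_distrib, prod_const,
    card_univ, Fintype.card_fin, map_div₀, map_pow, map_natCast, map_prod]
  congr 1
  refine prod_congr rfl fun j _ => ?_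
  change _ = PadicInt.Coe.ringHom _
  rw [ascPochhammer_eval_eq_prod_range, map_prod, map_prod]
  refine prod_congr rfl fun i _ => ?_
  rw [map_add, map_add, map_natCast, map_natCast]
  exact congrArg (· + (i : ℚ_[p])) (hb j).symm

theorem map_hypG {a : Fin n → ℚ} {b : Fin n → ℤ_[p]} (hb : ∀ j, (b j : ℚ_[p]) = a j) :
    PowerSeries.map (Rat.castHom ℚ_[p]) (hypG a) =
      PowerSeries.mk fun k => padicCoeff b k * padicHarm b k := by
  ext k
  have hF := congrArg (coeff k) (map_hypF hb)
  rw [coeff_map, hypF, coeff_mk, coeff_mk] at hF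
  rw [coeff_map, hypG, coeff_mk, coeff_mk, map_mul, hF, padicHarm]
  simp [hb]

/-- Dwork's congruence for the ratio `G / F`, obtained by dividing by the integral units `F_b(z)` and
`F_{b'}(z^p)`. -/
theorem exists_expand_ratio_sub {a a' : Fin n → ℚ} {b b' : Fin n → ℤ_[p]} {c : Fin n → ℕ}
    (hb : ∀ j, (b j : ℚ_[p]) = a j) (hb' : ∀ j, (b' j : ℚ_[p]) = a' j)
    (h : ∀ j, IsShift (b j) (b' j) (c j)) :
    ∃ w ∈ integralSeries p, expand p hp.out.ne_zero
        (PowerSeries.map (Rat.castHom ℚ_[p]) (hypG a' * (hypF a')⁻¹)) -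
      (p : ℚ_[p]⟦X⟧) * PowerSeries.map (Rat.castHom ℚ_[p]) (hypG a * (hypF a)⁻¹) =
        (p : ℚ_[p]⟦X⟧) * w := by
  have hinv : ∀ a : Fin n → ℚ, PowerSeries.map (Rat.castHom ℚ_[p]) (hypF a)⁻¹ *
      PowerSeries.map (Rat.castHom ℚ_[p]) (hypF a) = 1 := by
    intro a
    rw [← map_mul, PowerSeries.inv_mul_cancel _ (by simp [constantCoeff_hypF]), map_one]
  have hi := hinv a
  have hi' := congrArg (expand p hp.out.ne_zero) (hinv a')
  rw [map_mul, map_one] at hi'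
  rw [map_mul, map_mul, map_mul, map_hypG hb, map_hypG hb']
  rw [map_hypF hb] at hi
  rw [map_hypF hb'] at hi'
  set F := PowerSeries.mk (padicCoeff b) with hF
  set F' := PowerSeries.mk (padicCoeff b') with hF'
  set G := PowerSeries.mk fun k => padicCoeff b k * padicHarm b k with hG
  set G' := PowerSeries.mk fun k => padicCoeff b' k * padicHarm b' k with hG'
  have key : ∃ w ∈ integralSeries p, expand p hp.out.ne_zero G' * F -
      (p : ℚ_[p]⟦X⟧) * (expand p hp.out.ne_zero F' * G) = (p : ℚ_[p]⟦X⟧) * w := by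
    rw [natCast_mul_mem_iff]
    intro k
    obtain ⟨e, he, hes⟩ := dwork_congruence h (k / p) (Nat.mod_lt k hp.out.pos)
    refine ⟨e, he, ?_⟩
    rw [map_sub, ← map_natCast (C (R := ℚ_[p])), coeff_C_mul, coeff_expand_mul_eq_sum,
      coeff_expand_mul_eq_sum, ← hes, mul_sum, ← sum_sub_distrib]
    simp only [hF, hF', hG, hG', coeff_mk]
  obtain ⟨w, hw, hws⟩ := key
  have hFm : ∀ b : Fin n → ℤ_[p], (PowerSeries.mk (padicCoeff b))⁻¹ ∈ integralSeries p := by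
    intro b
    refine inv_mem_integralSeries (mem_integralSeries.mpr fun k => ?_) ?_
    · rw [coeff_mk]; exact padicCoeff_mem b k
    · rw [← coeff_zero_eq_constantCoeff_apply, coeff_mk, padicCoeff_zero]
  have hFi : PowerSeries.map (Rat.castHom ℚ_[p]) (hypF a)⁻¹ = F⁻¹ := by
    rw [PowerSeries.eq_inv_iff_mul_eq_one, hi]
    rw [← coeff_zero_eq_constantCoeff_apply, hF, coeff_mk, padicCoeff_zero]
    exact one_ne_zero
  have hFi' : PowerSeries.map (Rat.castHom ℚ_[p]) (hypF a')⁻¹ = F'⁻¹ := by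
    rw [PowerSeries.eq_inv_iff_mul_eq_one, hF', ← map_hypF hb', hinv]
    rw [← coeff_zero_eq_constantCoeff_apply, hF', coeff_mk, padicCoeff_zero]
    exact one_ne_zero
  rw [hFi] at hi ⊢
  rw [hFi'] at hi' ⊢
  have hem : expand p hp.out.ne_zero F'⁻¹ ∈ integralSeries p := by
    refine mem_integralSeries.mpr fun k => ?_
    rw [coeff_expand]
    split_ifs
    · exact mem_integralSeries.mp (hFm b') _
    · exact zero_mem _
  refine ⟨w * F⁻¹ * expand p hp.out.ne_zero F'⁻¹, mul_mem (mul_mem hw (hFm b)) hem, ?_⟩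
  linear_combination F⁻¹ * expand p hp.out.ne_zero F'⁻¹ * hws -
    expand p hp.out.ne_zero G' * expand p hp.out.ne_zero F'⁻¹ * hi +
    (p : ℚ_[p]⟦X⟧) * G * F⁻¹ * hi'

theorem ratio_eq_of_entries_eq {a b : Fin n → ℚ} (h : entries a = entries b) :
    hypG a * (hypF a)⁻¹ = hypG b * (hypF b)⁻¹ := by
  have hc : ∀ k, hypCoeff a k = hypCoeff b k := by
    intro k
    have := congrArg (fun s => (s.map fun x => (ascPochhammer ℚ k).eval x).prod) h
    simp only [entries, Multiset.map_map] at this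
    simp only [hypCoeff]
    congr 1
  have hF : hypF a = hypF b := by ext k; simp [hypF, hc]
  have hG : hypG a = hypG b := by
    ext k
    have := congrArg (fun s => (s.map fun x : ℚ =>
      ∑ i ∈ range k, (1 / (x + (i : ℚ)) - 1 / (1 + (i : ℚ)))).sum) h
    simp only [entries, Multiset.map_map] at this
    simp only [hypG, coeff_mk, hc]
    congr 1
  rw [hF, hG]


theorem ratio_dwork {p n : ℕ} {a : Fin n → ℚ} (ha : ∀ i, 0 < a i ∧ a i < 1) (h : DworkCondition p a) :
    hypG (fun i => dwork p (a i)) * (hypF fun i => dwork p (a i))⁻¹ = hypG a * (hypF a)⁻¹ := by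
  rcases h with h | ⟨rfl, h⟩
  · exact ratio_eq_of_entries_eq h
  · rw [ratio_eq_of_entries_eq h, ratio_reflection a ha]

theorem constantCoeff_ratio (a : Fin n → ℚ) : constantCoeff (hypG a * (hypF a)⁻¹) = 0 := by
  rw [map_mul, constantCoeff_hypG, zero_mul]

theorem pIntegral_mirrorMap {a : Fin n → ℚ} (ha : ∀ i, 0 < a i ∧ a i < 1)
    (hg : IsGoodPrime p a) (h : DworkCondition p a) : PIntegral p (mirrorMap a) := by
  have hp0 : (p : ℚ) ≠ 0 := by exact_mod_cast hp.out.ne_zero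
  have hd := fun j => dworkDigit_spec hp.out (hg.2 j)
  obtain ⟨w, hw, hws⟩ := exists_expand_ratio_sub (p := p) (a := a)
    (a' := fun j => dwork p (a j)) (b := fun j => ⟨a j, Padic.norm_rat_le_one (hg.2 j)⟩)
    (b' := fun j => ⟨dwork p (a j), Padic.norm_rat_le_one (hd j).2⟩)
    (c := fun j => dworkDigit p (a j)) (fun _ => rfl) (fun _ => rfl) (fun j => ⟨(hd j).1, by
      refine PadicInt.ext ?_
      change (p : ℚ_[p]) * ((dwork p (a j) : ℚ) : ℚ_[p]) = (a j : ℚ_[p]) + (dworkDigit p (a j) : ℚ_[p])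
      have : (p : ℚ) * dwork p (a j) = a j + dworkDigit p (a j) := by
        rw [dwork]; field_simp
      exact_mod_cast congrArg (fun x : ℚ => (x : ℚ_[p])) this⟩)
  rw [ratio_dwork ha h] at hws
  have h0 := constantCoeff_ratio a
  have h0' : constantCoeff (PowerSeries.map (Rat.castHom ℚ_[p]) (hypG a * (hypF a)⁻¹)) = 0 := by
    rw [← coeff_zero_eq_constantCoeff_apply, coeff_map, coeff_zero_eq_constantCoeff_apply, h0,
      map_zero]
  rw [pIntegral_iff, mirrorMap, map_mul, map_X]
  refine mul_mem (mem_integralSeries.mpr fun k => ?_) ?_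
  · rw [coeff_X]
    split_ifs
    exacts [one_mem _, zero_mem _]
  · have := expSeries_mem_integralSeries h0' hw hws
    rwa [← map_expSeries _ h0] at this

end GoodPrimes

/-! ### Growth at an arbitrary prime and `N`-integrality -/

section AllPrimes

open PowerSeries

variable {p : ℕ} [hp : Fact p.Prime] {n : ℕ}

theorem inv_norm_natCast_le {N : ℕ} (hN : N ≠ 0) : ‖(N : ℚ_[p])‖⁻¹ ≤ N := by
  have h0 : (N : ℚ_[p]) ≠ 0 := by exact_mod_cast hN
  rw [Padic.norm_eq_zpow_neg_valuation h0, Padic.valuation_natCast, zpow_neg, inv_inv, zpow_natCast]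
  exact_mod_cast Nat.le_of_dvd (Nat.pos_of_ne_zero hN) pow_padicValNat_dvd

theorem inv_norm_factorial_le (k : ℕ) : ‖(k.factorial : ℚ_[p])‖⁻¹ ≤ (p : ℝ) ^ k := by
  have h0 : (k.factorial : ℚ_[p]) ≠ 0 := by exact_mod_cast k.factorial_ne_zero
  rw [Padic.norm_eq_zpow_neg_valuation h0, Padic.valuation_natCast, zpow_neg, inv_inv, zpow_natCast]
  exact pow_le_pow_right₀ (by exact_mod_cast hp.out.one_lt.le) (padicValNat_factorial_le p k)

/-- The inverse of `x + i` has denominator at most `x.den * (i + 1)`, and the `p`-adic absolute value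
of a rational number is at most its denominator. -/
theorem norm_one_div_add_natCast_le {x : ℚ} (hx : 0 < x ∧ x ≤ 1) (i : ℕ) :
    ‖((1 / (x + i) : ℚ) : ℚ_[p])‖ ≤ x.den * (i + 1) := by
  have hnum : 0 < x.num := Rat.num_pos.mpr hx.1
  obtain ⟨m, hm⟩ := Int.eq_ofNat_of_zero_le hnum.le
  have hxq : x * x.den = m := by
    have h1 := Rat.mul_den_eq_num x
    rw [hm] at h1
    exact_mod_cast h1
  have hmd : (m : ℚ) ≤ x.den := by
    rw [← hxq]; exact mul_le_of_le_one_left (by positivity) hx.2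
  have e : 1 / (x + i) = (x.den : ℚ) / ((m + i * x.den : ℕ) : ℚ) := by
    push_cast
    rw [← hxq, ← add_mul]
    have : x + i ≠ 0 := by have := hx.1; positivity
    field_simp
  have hN : m + i * x.den ≠ 0 := by omega
  rw [e, Rat.cast_div, Rat.cast_natCast, Rat.cast_natCast, norm_div, div_eq_mul_inv]
  calc ‖(x.den : ℚ_[p])‖ * ‖((m + i * x.den : ℕ) : ℚ_[p])‖⁻¹
      ≤ 1 * ((m + i * x.den : ℕ) : ℝ) := by
        gcongr
        · exact_mod_cast Padic.norm_int_le_one (x.den : ℤ)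
        · exact inv_norm_natCast_le hN
    _ ≤ x.den * (i + 1) := by
        have : (m : ℝ) ≤ x.den := by exact_mod_cast hmd
        push_cast
        linarith

variable (p) in
/-- The coefficients of `F` have at most exponential `p`-adic growth. -/
theorem exists_norm_hypCoeff_le (a : Fin n → ℚ) :
    ∃ D : ℝ, 1 ≤ D ∧ ∀ k, ‖(hypCoeff a k : ℚ_[p])‖ ≤ D ^ k := by
  set c : ℝ := 1 + ∑ j, ‖(a j : ℚ_[p])‖ with hc
  have hc1 : 1 ≤ c := by
    rw [hc]; exact le_add_of_nonneg_right (sum_nonneg fun _ _ => norm_nonneg _)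
  have hp1 : (1 : ℝ) ≤ p := by exact_mod_cast hp.out.one_lt.le
  refine ⟨(c * p) ^ n, one_le_pow₀ (one_le_mul_of_one_le_of_one_le hc1 hp1), fun k => ?_⟩
  have h1 : ∀ j i, ‖(a j : ℚ_[p]) + (i : ℕ)‖ ≤ c := by
    intro j i
    refine (norm_add_le _ _).trans ?_
    have h2 := single_le_sum (f := fun j => ‖(a j : ℚ_[p])‖) (fun _ _ => norm_nonneg _) (mem_univ j)
    have h3 : ‖(i : ℚ_[p])‖ ≤ 1 := by exact_mod_cast Padic.norm_int_le_one (i : ℤ)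
    linarith
  simp only [hypCoeff, ascPochhammer_eval_eq_prod_range]
  push_cast
  rw [norm_div, norm_prod, norm_pow, div_eq_mul_inv, ← inv_pow, ← pow_mul, mul_comm n k, pow_mul,
    mul_pow, mul_pow]
  gcongr
  · calc ∏ j, ‖∏ i ∈ range k, ((a j : ℚ_[p]) + (i : ℕ))‖ ≤ ∏ _j : Fin n, c ^ k := by
          refine prod_le_prod (fun _ _ => norm_nonneg _) fun j _ => ?_
          rw [norm_prod]
          calc _ ≤ ∏ _i ∈ range k, c := prod_le_prod (fun _ _ => norm_nonneg _) fun i _ => h1 j i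
            _ = c ^ k := by simp
      _ = (c ^ k) ^ n := by simp
  · exact inv_norm_factorial_le k

variable (p) in
/-- The coefficients of `G` have at most exponential `p`-adic growth. -/
theorem exists_norm_coeff_hypG_le {a : Fin n → ℚ} (ha : ∀ i, 0 < a i ∧ a i < 1) :
    ∃ D : ℝ, 1 ≤ D ∧ ∀ k, ‖((coeff k (hypG a) : ℚ) : ℚ_[p])‖ ≤ D ^ k := by
  obtain ⟨D, hD1, hD⟩ := exists_norm_hypCoeff_le p a
  set d : ℝ := 1 + ∑ j, ((a j).den : ℝ) with hd
  have hd1 : 1 ≤ d := by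
    rw [hd]; exact le_add_of_nonneg_right (sum_nonneg fun _ _ => by positivity)
  refine ⟨D * (d * 2), one_le_mul_of_one_le_of_one_le hD1 (by linarith), fun k => ?_⟩
  rcases Nat.eq_zero_or_pos k with rfl | hk
  · simp [hypG]
  rw [hypG, coeff_mk, Rat.cast_mul, norm_mul, mul_pow]
  gcongr
  · exact hD k
  have hdk : d * k ≤ (d * 2) ^ k := by
    rw [mul_pow]
    gcongr
    · exact le_self_pow₀ hd1 hk.ne'
    · exact_mod_cast Nat.lt_two_pow_self.le
  refine le_trans ?_ hdk
  have h0 : 0 ≤ d * k := by positivity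
  rw [Rat.cast_sum]
  refine IsUltrametricDist.norm_sum_le_of_forall_le_of_nonneg h0 fun j _ => ?_
  rw [Rat.cast_sum]
  refine IsUltrametricDist.norm_sum_le_of_forall_le_of_nonneg h0 fun i hi => ?_
  have hik : (i : ℝ) + 1 ≤ k := by exact_mod_cast mem_range.mp hi
  have hdj : ((a j).den : ℝ) ≤ d := by
    have := single_le_sum (f := fun j => ((a j).den : ℝ)) (fun _ _ => by positivity) (mem_univ j)
    linarith
  rw [Rat.cast_sub, sub_eq_add_neg]
  refine (IsUltrametricDist.norm_add_le_max _ _).trans (max_le ?_ ?_)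
  · refine (norm_one_div_add_natCast_le ⟨(ha j).1, (ha j).2.le⟩ i).trans ?_
    gcongr
  · rw [norm_neg]
    refine (norm_one_div_add_natCast_le (p := p) (x := 1) (by norm_num) i).trans ?_
    have : ((1 : ℚ).den : ℝ) = 1 := by simp
    rw [this]
    gcongr

variable (p) in
/-- After a substitution `z ↦ p^m z` the mirror map is integral at `p`, whether `p` is good or not. -/
theorem exists_pIntegral_rescale {a : Fin n → ℚ} (ha : ∀ i, 0 < a i ∧ a i < 1) :
    ∃ m : ℕ, PIntegral p (rescale ((p : ℚ) ^ m) (mirrorMap a)) := by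
  have hp0 : (p : ℚ_[p]) ≠ 0 := by exact_mod_cast hp.out.ne_zero
  have hp1 : (1 : ℝ) < p := by exact_mod_cast hp.out.one_lt
  have hpp : (0 : ℝ) < p := by positivity
  obtain ⟨D₁, h1, hD₁⟩ := exists_norm_hypCoeff_le p a
  obtain ⟨D₂, h2, hD₂⟩ := exists_norm_coeff_hypG_le p ha
  obtain ⟨m, hm⟩ := pow_unbounded_of_one_lt (p * max D₁ D₂) hp1
  refine ⟨m, ?_⟩
  have hscale : ∀ (k : ℕ) (x : ℚ_[p]), ‖x‖ ≤ (max D₁ D₂) ^ k →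
      ‖((p : ℚ_[p]) ^ m) ^ k * x‖ ≤ ((p : ℝ)⁻¹) ^ k := by
    intro k x hx
    rw [norm_mul, norm_pow, norm_pow, Padic.norm_p]
    calc (((p : ℝ)⁻¹ ^ m)) ^ k * ‖x‖ ≤ ((p : ℝ)⁻¹ ^ m) ^ k * (max D₁ D₂) ^ k := by gcongr
      _ = ((p : ℝ)⁻¹ ^ m * max D₁ D₂) ^ k := (mul_pow _ _ _).symm
      _ ≤ _ := by
        refine pow_le_pow_left₀ (by positivity) ?_ k
        rw [inv_pow, inv_mul_le_iff₀ (by positivity), ← div_eq_mul_inv, le_div_iff₀ hpp, mul_comm]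
        exact hm.le
  set φ := Rat.castHom ℚ_[p] with hφ
  have hcomm : ∀ f : ℚ⟦X⟧, PowerSeries.map φ (rescale ((p : ℚ) ^ m) f) =
      rescale ((p : ℚ_[p]) ^ m) (PowerSeries.map φ f) := by
    intro f; ext k; simp [coeff_rescale]
  have hF : rescale ((p : ℚ_[p]) ^ m) (PowerSeries.map φ (hypF a)) ∈ integralSeries p := by
    refine mem_integralSeries.mpr fun k => ?_
    rw [coeff_rescale, coeff_map, hypF, coeff_mk, PadicInt.mem_subring_iff]
    refine (hscale k _ ((hD₁ k).trans ?_)).trans (pow_le_one₀ (by positivity) (inv_le_one_of_one_le₀ hp1.le))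
    exact pow_le_pow_left₀ (by positivity) (le_max_left _ _) k
  have hF0 : constantCoeff (rescale ((p : ℚ_[p]) ^ m) (PowerSeries.map φ (hypF a))) = 1 := by
    rw [← coeff_zero_eq_constantCoeff_apply, coeff_rescale, coeff_map,
      coeff_zero_eq_constantCoeff_apply, constantCoeff_hypF]
    simp
  have hG : ∃ h ∈ integralSeries p, rescale ((p : ℚ_[p]) ^ m) (PowerSeries.map φ (hypG a)) =
      (p : ℚ_[p]⟦X⟧) * h := by
    refine (natCast_mul_mem_iff _).mpr fun k => ?_
    rw [coeff_rescale, coeff_map]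
    rcases Nat.eq_zero_or_pos k with rfl | hk
    · exact ⟨0, zero_mem _, by simp [constantCoeff_hypG]⟩
    refine ⟨((p : ℚ_[p]) ^ m) ^ k * φ (coeff k (hypG a)) / p, ?_, by field_simp⟩
    rw [PadicInt.mem_subring_iff, norm_div, Padic.norm_p, div_inv_eq_mul]
    have h3 := hscale k _ ((hD₂ k).trans (pow_le_pow_left₀ (by positivity) (le_max_right D₁ D₂) k))
    have h4 : ((p : ℝ)⁻¹) ^ k ≤ (p : ℝ)⁻¹ :=
      pow_le_of_le_one (by positivity) (inv_le_one_of_one_le₀ hp1.le) hk.ne'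
    calc _ ≤ (p : ℝ)⁻¹ * p := mul_le_mul_of_nonneg_right (h3.trans h4) hpp.le
      _ = 1 := inv_mul_cancel₀ hpp.ne'
  obtain ⟨h, hh, hhs⟩ := hG
  have hratio : PowerSeries.map φ (rescale ((p : ℚ) ^ m) (hypG a * (hypF a)⁻¹)) =
      (p : ℚ_[p]⟦X⟧) * (h * (rescale ((p : ℚ_[p]) ^ m) (PowerSeries.map φ (hypF a)))⁻¹) := by
    rw [← mul_assoc, ← hhs, PowerSeries.eq_mul_inv_iff_mul_eq (by simp [hF0]), ← hcomm, ← hcomm,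
      ← map_mul, ← map_mul, mul_assoc,
      PowerSeries.inv_mul_cancel _ (by simp [constantCoeff_hypF]), mul_one]
  have h0 := constantCoeff_ratio a
  have h0' : constantCoeff (rescale ((p : ℚ) ^ m) (hypG a * (hypF a)⁻¹)) = 0 := by
    rw [← coeff_zero_eq_constantCoeff_apply, coeff_rescale, coeff_zero_eq_constantCoeff_apply, h0,
      mul_zero]
  have hh0 : constantCoeff (h * (rescale ((p : ℚ_[p]) ^ m) (PowerSeries.map φ (hypF a)))⁻¹) = 0 := by
    have h5 := congrArg (constantCoeff (R := ℚ_[p])) hratio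
    rw [← coeff_zero_eq_constantCoeff_apply, coeff_map, coeff_zero_eq_constantCoeff_apply, h0',
      map_zero, map_mul, map_natCast] at h5
    exact (mul_eq_zero.mp h5.symm).resolve_left hp0
  obtain ⟨w, hw, hws⟩ :=
    exists_expSeries_mul (mul_mem hh (inv_mem_integralSeries hF hF0)) hh0
  have hpm : (p : ℚ_[p]⟦X⟧) ∈ integralSeries p := natCast_mem _ p
  have hX : (X : ℚ_[p]⟦X⟧) ∈ integralSeries p := ⟨X, map_X _⟩
  rw [pIntegral_iff, mirrorMap, map_mul, map_mul, rescale_X]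
  change _ * PowerSeries.map φ (rescale ((p : ℚ) ^ m) (expSeries (hypG a * (hypF a)⁻¹))) ∈ _
  rw [rescale_expSeries h0, map_expSeries _ h0', hratio, hws, map_mul, map_X, map_C, map_pow,
    map_natCast, map_pow, map_natCast]
  exact mul_mem (mul_mem (pow_mem hpm m) hX) (add_mem (one_mem _) (mul_mem hpm hw))

theorem PIntegral.rescale_natCast {f : ℚ⟦X⟧} (hf : PIntegral p f) (N : ℕ) :
    PIntegral p (rescale (N : ℚ) f) := by
  intro k
  rw [coeff_rescale, ← norm_ratCast_le_one_iff, ← Nat.cast_pow, Rat.cast_mul, Rat.cast_natCast]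
  have h1 := (norm_ratCast_le_one_iff (p := p) _).mpr (hf k)
  rw [norm_mul]
  exact mul_le_one₀ (by exact_mod_cast Padic.norm_int_le_one ((N ^ k : ℕ) : ℤ)) (norm_nonneg _) h1

/-- A suitable power of each prime dividing a denominator of some `a i` is collected in `N`. -/
theorem nIntegral_mirrorMap {a : Fin n → ℚ} (ha : ∀ i, 0 < a i ∧ a i < 1)
    (h : ∀ p : ℕ, IsGoodPrime p a → PIntegral p (mirrorMap a)) : NIntegral (mirrorMap a) := by
  have hm : ∀ p : ℕ, ∃ m : ℕ, p.Prime → PIntegral p (rescale ((p : ℚ) ^ m) (mirrorMap a)) := by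
    intro p
    by_cases hp : p.Prime
    · have : Fact p.Prime := ⟨hp⟩
      obtain ⟨m, hm⟩ := exists_pIntegral_rescale p ha
      exact ⟨m, fun _ => hm⟩
    · exact ⟨0, fun h => absurd h hp⟩
  choose m hm using hm
  set S := (∏ i, (a i).den).primeFactors with hS
  refine ⟨∏ p ∈ S, p ^ m p, prod_pos fun p hp =>
    pow_pos (Nat.prime_of_mem_primeFactors hp).pos _, fun k => ?_⟩
  have key : ∀ p : ℕ, p.Prime →
      PIntegral p (rescale ((∏ p ∈ S, p ^ m p : ℕ) : ℚ) (mirrorMap a)) := by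
    intro p hp
    have : Fact p.Prime := ⟨hp⟩
    by_cases hpS : p ∈ S
    · rw [← mul_prod_erase S _ hpS, Nat.cast_mul, rescale_mul]
      simp only [RingHom.comp_apply]
      have := (hm p hp).rescale_natCast (∏ x ∈ S.erase p, x ^ m x)
      rwa [← Nat.cast_pow] at this
    · refine (h p ⟨hp, fun i hi => hpS ?_⟩).rescale_natCast _
      rw [hS, Nat.mem_primeFactors]
      exact ⟨hp, hi.trans (dvd_prod_of_mem _ (mem_univ i)),
        prod_ne_zero_iff.mpr fun i _ => (a i).den_ne_zero⟩
  have hden : (coeff k (rescale ((∏ p ∈ S, p ^ m p : ℕ) : ℚ) (mirrorMap a))).den = 1 := by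
    rw [Nat.eq_one_iff_not_exists_prime_dvd]
    exact fun p hp => key p hp k
  exact ⟨_, (Rat.coe_int_num_of_den_eq_one hden).symm⟩

end AllPrimes

end HypMirror

theorem theorem1 (n : ℕ) (a : Fin n → ℚ) (ha : ∀ i, 0 < a i ∧ a i < 1) :
    (∀ p : ℕ, HypMirror.IsGoodPrime p a → HypMirror.DworkCondition p a →
      HypMirror.PIntegral p (HypMirror.mirrorMap a)) ∧
    ((∀ p : ℕ, HypMirror.IsGoodPrime p a → HypMirror.DworkCondition p a) →
      HypMirror.NIntegral (HypMirror.mirrorMap a)) := by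
  have h1 : ∀ p : ℕ, HypMirror.IsGoodPrime p a → HypMirror.DworkCondition p a →
      HypMirror.PIntegral p (HypMirror.mirrorMap a) := fun p hg hc =>
    have : Fact p.Prime := ⟨hg.1⟩
    HypMirror.pIntegral_mirrorMap ha hg hc
  exact ⟨h1, fun h => HypMirror.nIntegral_mirrorMap ha fun p hg => h1 p hg (h p hg)⟩
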